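/- Let $A\in\mathbb R^{p\times n}$, let $I\subseteq\{1,\dots,p\}^2$ be an index set, $\lambda>0$, and let $t$ be the number of pairs $(i,j)\in I$ with $i\le j$. Let $L(\Omega)\in\mathbb R^t$ collect the entries $\Omega_{ij}$, $(i,j)\in I$, $i\le j$, of a $p\times p$ matrix $\Omega$, and put $e_1=L(I_p)$, $e_2=2L(E-I_p)$ ($E$ the all-one matrix), $S(Y)=\tfrac12L(YA^T+AY^T)$ for $Y\in\mathbb R^{p\times n}$, with adjoint $S^*$ for the Frobenius and Euclidean inner products. Consider $$(\mathbf P)\quad \max_{x\in\mathbb R^t}\ -\Gamma(x),\qquad \Gamma(x)=\tfrac12\|S^*(x)\|_F^2-\langle x,e_1\rangle+\tfrac{\lambda}{2}\|x\circ e_2\|_1,$$ $$(\mathbf D)\quad \min_{Y\in\mathbb R^{p\times n},\,z\in\mathbb R^t}\ \tfrac12\|Y\|_F^2+\delta_{b_\lambda}(z)\quad\text{s.t. } S(Y)+z=e_1,$$ where $b_\lambda=\{z\in\mathbb R^t: e_1\circ z=0,\ |z_i|\le\lambda\ \forall i\}$ and $\delta_{b_\lambda}$ is its indicator function. Let $\mathcal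 O$ be the solution set of $(\mathbf P)$. Let $\mathcal L(Y,z,x)=\tfrac12\|Y\|_F^2+\delta_{b_\lambda}(z)-\langle S(Y)+z-e_1,x\rangle$ be the Lagrangian of $(\mathbf D)$ and $\mathcal L_\sigma(Y,z;x)=\mathcal L(Y,z,x)+\tfrac\sigma2\|S(Y)+z-e_1\|^2$ the augmented Lagrangian. Put $\mathcal T_\Gamma=\partial\Gamma$ and $\mathcal T_{\mathcal L}(Y,z,x)=\{(Y',z',x'):(Y',z',-x')\in\partial\mathcal L(Y,z,x)\}$, where $\partial\mathcal L$ is the subdifferential in $(Y,z)$ times the superdifferential in $x$. For $r>0$, a number $\kappa\ge0$ is called an error bound modulus of a multifunction $F$ at radius $r$ if $\mathrm{dist}(u,F^{-1}(0))\le\kappa\,\mathrm{dist}(0,F(u))$ for all $u$ with $F(u)\ne\emptyset$ and $\mathrm{dist}(u,F^{-1}(0))\le r$. An infinite sequence $(Y^k,z^k,x^k)_{k\ge0}$ is generated by the inexact augmented Lagrangian method (ALM) with penalty parameters $0<\sigma_0\le\sigma_1\le\cdots$, $\sigma_k\uparrow\sigma_\infty\in(0,\infty]$, if $x^{k+1}=x^k-\sigma_k(S(Y^{k+1})+z^{k+1}-e_1)$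 for all $k\ge0$, where $(Y^{k+1},z^{k+1})$ is an approximate minimiser of $\Psi_k=\mathcal L_{\sigma_k}(\cdot\,;x^k)$ in the sense of the following stopping criteria: * (A) $\Psi_k(Y^{k+1},z^{k+1})-\inf\Psi_k\le\epsilon_k^2/(2\sigma_k)$, with $\epsilon_k\ge0$ and $\sum_k\epsilon_k\le\alpha_\epsilon<\infty$; * (S1) $\Psi_k(Y^{k+1},z^{k+1})-\inf\Psi_k\le\frac{\theta_k^2}{2\sigma_k}\|x^{k+1}-x^k\|^2$, with $\theta_k\ge0$ and $\sum_k\theta_k<\infty$; * (S2) $\mathrm{dist}(0,\partial\Psi_k(Y^{k+1},z^{k+1}))\le\frac{\theta'_k}{\sigma_k}\|x^{k+1}-x^k\|$, with $0\le\theta'_k\to0$. **Theorem.** Suppose $\mathcal O\ne\emptyset$ and let $r>0$. Then $\mathcal T_\Gamma$ has an error bound modulus at radius $r$, $(\mathbf D)$ has a unique optimal solution $(Y^*,z^*)$, and $\mathcal T_{\mathcal L}$ has an error bound modulus $\kappa_l$ at radius $r$, depending only on $A,I,\lambda,r$, such that the following holds for every error bound modulus $\kappa_\gamma\ge 0$ of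 $\mathcal T_\Gamma$ at radius $r$ and every infinite sequence $(Y^k,z^k,x^k)$ generated by the inexact ALM under (A) and (S1) with $\mathrm{dist}(x^0,\mathcal O)\le r-\alpha_\epsilon$. 1. $x^k$ converges to some $x^*\in\mathcal O$. For every $k\ge0$ with $\theta_k<1$ (hence for all large $k$, and for all $k\ge0$ if all $\theta_k<1$), $$\mathrm{dist}(x^{k+1},\mathcal O)\le\zeta_k\,\mathrm{dist}(x^k,\mathcal O),\qquad \zeta_k=\Big(\frac{\kappa_\gamma(\theta_k+1)}{(\kappa_\gamma^2+\sigma_k^2)^{1/2}}+\theta_k\Big)(1-\theta_k)^{-1},$$ and $\zeta_k\to\zeta_\infty=\kappa_\gamma(\kappa_\gamma^2+\sigma_\infty^2)^{-1/2}<1$ (with $\zeta_\infty=0$ if $\sigma_\infty=\infty$). 2. (Linear rate.) There are $C$ and $\rho\in(0,1)$ with $\mathrm{dist}(x^k,\mathcal O)\le C\rho^k$ for all $k\ge 0$. If $(\theta_k)$ is nonincreasing, $\theta_0<1$ and $\zeta_0<1$, then $(\zeta_k)$ is nonincreasing and $\mathrm{dist}(x^{k+1},\mathcal O)\le\zeta_0\,\mathrm{dist}(x^k,\mathcal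 O)$ for all $k\ge0$. 3. (Superlinear rate.) If $\sigma_\infty=\infty$, then $\mathrm{dist}(x^{k+1},\mathcal O)=o(\mathrm{dist}(x^k,\mathcal O))$ as $k\to\infty$. 4. $(Y^k,z^k)\to(Y^*,z^*)$. If moreover (S2) holds, then for all $k\ge0$ $$\|(Y^{k+1},z^{k+1})-(Y^*,z^*)\|\le\zeta'_k\|x^{k+1}-x^k\|,\qquad \zeta'_k=\kappa_l(1+\theta'_k)/\sigma_k\to\zeta'_\infty=\kappa_l/\sigma_\infty$$ (with $\zeta'_\infty=0$ if $\sigma_\infty=\infty$). For an arbitrary error bound modulus $\kappa\ge0$ of $\mathcal T_{\mathcal L}$ at an arbitrary radius $R>0$, the same inequality with $\kappa$ in place of $\kappa_l$ holds for all sufficiently large $k$. -/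

import Mathlib

open Filter Topology Matrix

noncomputable section

namespace DTraceALM

/-! ### Generic convex analysis -/

section Generic

variable {E : Type*} [NormedAddCommGroup E] [InnerProductSpace ℝ E]

/-- The convex subdifferential of an extended-real-valued function: `v ∈ ∂f(x)` iff
`f(y) ≥ f(x) + ⟨v, y - x⟩` for all `y`.  For a proper `f` it is empty outside the domain of `f`. -/
def subdiff (f : E → EReal) (x : E) : Set E :=
  {v | ∀ y, f x + ((inner ℝ v (y - x) : ℝ) : EReal) ≤ f y}

open Classical in
/-- The indicator function of a set (`0` on the set, `+∞` outside). -/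
def indicatorFn (C : Set E) (z : E) : EReal := if z ∈ C then 0 else ⊤

/-- `F⁻¹(0)` for a multifunction `F`. -/
def zeros (F : E → Set E) : Set E := {x | 0 ∈ F x}

/-- The error bound `dist(x, F⁻¹(0)) ≤ κ dist(0, F(x))` for all `x` in the effective domain of `F`
with `dist(x, F⁻¹(0)) ≤ r`.  It is used only for `F⁻¹(0)` nonempty, so that no distance in it is
a distance to the empty set. -/
def HasErrorBound (F : E → Set E) (r κ : ℝ) : Prop :=
  ∀ x, (F x).Nonempty → Metric.infDist x (zeros F) ≤ r →
    Metric.infDist x (zeros F) ≤ κ * Metric.infDist 0 (F x)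

end Generic

/-! ### The reduced problem -/

/-- Positions of the upper triangle (diagonal included) that belong to the index set `I`;
the number of these positions is `t`. -/
abbrev Idx {p : ℕ} (I : Finset (Fin p × Fin p)) : Type :=
  {ij : Fin p × Fin p // ij ∈ I ∧ ij.1 ≤ ij.2}

/-- `ℝ^t` with its Euclidean norm, coordinates indexed by the kept upper triangular positions. -/
abbrev Vec {p : ℕ} (I : Finset (Fin p × Fin p)) : Type := EuclideanSpace ℝ (Idx I)

/-- `p × n` matrices with the Frobenius inner product. -/
abbrev FMat (p n : ℕ) : Type := EuclideanSpace ℝ (Fin p × Fin n)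

/-- An element of `FMat p n` as a matrix. -/
def FMat.toMatrix {p n : ℕ} (Y : FMat p n) : Matrix (Fin p) (Fin n) ℝ :=
  Matrix.of fun i j => Y (i, j)

/-- The dual space `ℝ^{p × n} × ℝ^t` with norm `(‖Y‖_F² + ‖z‖²)^{1/2}`. -/
abbrev DualSp {p : ℕ} (n : ℕ) (I : Finset (Fin p × Fin p)) : Type :=
  WithLp 2 (FMat p n × Vec I)

/-- The space `(ℝ^{p × n} × ℝ^t) × ℝ^t` of triples `(Y, z, x)` with its Euclidean norm. -/
abbrev KKTSp {p : ℕ} (n : ℕ) (I : Finset (Fin p × Fin p)) : Type :=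
  WithLp 2 (DualSp n I × Vec I)

/-- `L(Ω)`: the kept components of the upper triangle of `Ω`. -/
def opL {p : ℕ} (I : Finset (Fin p × Fin p)) (Ω : Matrix (Fin p) (Fin p) ℝ) : Vec I :=
  WithLp.toLp 2 fun ij => Ω ij.1.1 ij.1.2

/-- `e₁ = L(I_p)`. -/
def e1 {p : ℕ} (I : Finset (Fin p × Fin p)) : Vec I := opL I 1

/-- `e₂ = 2 L(E - I_p)` with `E` the all-one matrix. -/
def e2 {p : ℕ} (I : Finset (Fin p × Fin p)) : Vec I :=
  (2 : ℝ) • opL I (Matrix.of (fun _ _ => (1 : ℝ)) - 1)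

/-- `S(Y) = ½ L(Y Aᵀ + A Yᵀ)`. -/
def opS {p n : ℕ} (A : Matrix (Fin p) (Fin n) ℝ) (I : Finset (Fin p × Fin p)) :
    FMat p n →ₗ[ℝ] Vec I where
  toFun Y := (1 / 2 : ℝ) • opL I (Y.toMatrix * Aᵀ + A * Y.toMatrixᵀ)
  map_add' Y Z := by
    ext ij
    simp only [opL, FMat.toMatrix, PiLp.smul_apply, PiLp.add_apply, Matrix.add_apply,
      Matrix.mul_apply, Matrix.transpose_apply, Matrix.of_apply, smul_eq_mul,
      ← Finset.sum_add_distrib, Finset.mul_sum]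
    refine Finset.sum_congr rfl fun k _ => ?_
    ring
  map_smul' c Y := by
    ext ij
    simp only [opL, FMat.toMatrix, PiLp.smul_apply, Matrix.add_apply,
      Matrix.mul_apply, Matrix.transpose_apply, Matrix.of_apply, smul_eq_mul,
      ← Finset.sum_add_distrib, Finset.mul_sum, RingHom.id_apply]
    refine Finset.sum_congr rfl fun k _ => ?_
    ring

/-- The adjoint `S*`. -/
def opSadj {p n : ℕ} (A : Matrix (Fin p) (Fin n) ℝ) (I : Finset (Fin p × Fin p)) :
    Vec I →ₗ[ℝ] FMat p n :=
  LinearMap.adjoint (opS A I)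

/-- `Γ(x) = ½ ‖S* x‖_F² - ⟨x, e₁⟩ + (λ/2) ‖x ∘ e₂‖₁`. -/
def Gam {p n : ℕ} (A : Matrix (Fin p) (Fin n) ℝ) (I : Finset (Fin p × Fin p)) (lam : ℝ)
    (x : Vec I) : ℝ :=
  1 / 2 * ‖opSadj A I x‖ ^ 2 - inner ℝ x (e1 I) + lam / 2 * ∑ i, |x i * e2 I i|

/-- The solution set `𝒪` of `(P)`: `max_x -Γ(x)`. -/
def primalSolutions {p n : ℕ} (A : Matrix (Fin p) (Fin n) ℝ) (I : Finset (Fin p × Fin p))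
    (lam : ℝ) : Set (Vec I) :=
  {x | IsMaxOn (fun y => -Gam A I lam y) Set.univ x}

/-- `b_λ = {z | e₁ ∘ z = 0, |z_i| ≤ λ}`. -/
def bset {p : ℕ} (I : Finset (Fin p × Fin p)) (lam : ℝ) : Set (Vec I) :=
  {z | ∀ i, e1 I i * z i = 0 ∧ |z i| ≤ lam}

/-- The objective `½ ‖Y‖_F² + δ_{b_λ}(z)` of `(D)`. -/
def dualObj {p n : ℕ} (I : Finset (Fin p × Fin p)) (lam : ℝ) (w : DualSp n I) : EReal :=
  ((1 / 2 * ‖w.fst‖ ^ 2 : ℝ) : EReal) + indicatorFn (bset I lam) w.snd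

/-- The residual `S(Y) + z - e₁` of the constraint of `(D)`. -/
def resid {p n : ℕ} (A : Matrix (Fin p) (Fin n) ℝ) (I : Finset (Fin p × Fin p))
    (w : DualSp n I) : Vec I :=
  opS A I w.fst + w.snd - e1 I

/-- The optimal solutions of `(D)`: feasible points of finite objective value that minimise
the objective over all feasible points. -/
def dualSolutions {p n : ℕ} (A : Matrix (Fin p) (Fin n) ℝ) (I : Finset (Fin p × Fin p))
    (lam : ℝ) : Set (DualSp n I) :=
  {w | resid A I w = 0 ∧ dualObj I lam w < ⊤ ∧
    ∀ w', resid A I w' = 0 → dualObj I lam w ≤ dualObj I lam w'}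

/-- The Lagrangian `½ ‖Y‖_F² + δ_{b_λ}(z) - ⟨S(Y) + z - e₁, x⟩` of `(D)`. -/
def lagr {p n : ℕ} (A : Matrix (Fin p) (Fin n) ℝ) (I : Finset (Fin p × Fin p)) (lam : ℝ)
    (w : DualSp n I) (x : Vec I) : EReal :=
  dualObj I lam w + ((-inner ℝ (resid A I w) x : ℝ) : EReal)

/-- The augmented Lagrangian `ℒ_σ(Y, z; x)` of `(D)`. -/
def augLagr {p n : ℕ} (A : Matrix (Fin p) (Fin n) ℝ) (I : Finset (Fin p × Fin p)) (lam sig : ℝ)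
    (x : Vec I) (w : DualSp n I) : EReal :=
  lagr A I lam w x + ((sig / 2 * ‖resid A I w‖ ^ 2 : ℝ) : EReal)

/-- `𝒯_Γ = ∂Γ`. -/
def TGam {p n : ℕ} (A : Matrix (Fin p) (Fin n) ℝ) (I : Finset (Fin p × Fin p)) (lam : ℝ)
    (x : Vec I) : Set (Vec I) :=
  subdiff (fun y => ((Gam A I lam y : ℝ) : EReal)) x

/-- `𝒯_ℒ(Y, z, x) = {(Y', z', x') | (Y', z', -x') ∈ ∂ℒ(Y, z, x)}`, where `∂ℒ` is the
subdifferential of the convex-concave function `ℒ`: the convex subdifferential in `(Y, z)` times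
the concave superdifferential in `x`, so that `-x'` is a supergradient of `ℒ(Y, z, ·)` iff `x'` is
a subgradient of `-ℒ(Y, z, ·)`. -/
def TLag {p n : ℕ} (A : Matrix (Fin p) (Fin n) ℝ) (I : Finset (Fin p × Fin p)) (lam : ℝ)
    (u : KKTSp n I) : Set (KKTSp n I) :=
  {u' | u'.fst ∈ subdiff (fun w => lagr A I lam w u.snd) u.fst ∧
    u'.snd ∈ subdiff (fun x => -lagr A I lam u.fst x) u.snd}

/-! ### The inexact augmented Lagrangian method -/

/-- `(w^k, x^k)`, `w^k = (Y^k, z^k)`, is an infinite sequence generated by the inexact ALM with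
penalty parameters `σ_k ↑ σ_∞ ∈ (0, ∞]`.  How accurately `w^{k+1}` minimises
`Ψ_k = ℒ_{σ_k}(·; x^k)` is the matter of the stopping criteria below. -/
structure IsInexactALM {p n : ℕ} (A : Matrix (Fin p) (Fin n) ℝ) (I : Finset (Fin p × Fin p))
    (σ : ℕ → ℝ) (σinf : ENNReal) (w : ℕ → DualSp n I) (x : ℕ → Vec I) : Prop where
  sigma_pos : 0 < σ 0
  sigma_mono : Monotone σ
  sigma_lim : Tendsto (fun k => ENNReal.ofReal (σ k)) atTop (𝓝 σinf)
  update : ∀ k, x (k + 1) = x k - σ k • resid A I (w (k + 1))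

/-- `Ψ_k(Y^{k+1}, z^{k+1}) - inf Ψ_k`. -/
def subGap {p n : ℕ} (A : Matrix (Fin p) (Fin n) ℝ) (I : Finset (Fin p × Fin p)) (lam : ℝ)
    (σ : ℕ → ℝ) (w : ℕ → DualSp n I) (x : ℕ → Vec I) (k : ℕ) : EReal :=
  augLagr A I lam (σ k) (x k) (w (k + 1)) - ⨅ w', augLagr A I lam (σ k) (x k) w'

/-- The basic stopping criterion with tolerances `ε_k ≥ 0`, `∑ ε_k ≤ α < ∞`. -/
def StopA {p n : ℕ} (A : Matrix (Fin p) (Fin n) ℝ) (I : Finset (Fin p × Fin p)) (lam : ℝ)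
    (σ : ℕ → ℝ) (w : ℕ → DualSp n I) (x : ℕ → Vec I) (eps : ℕ → ℝ) (α : ℝ) : Prop :=
  (∀ k, 0 ≤ eps k) ∧ Summable eps ∧ ∑' k, eps k ≤ α ∧
    ∀ k, subGap A I lam σ w x k ≤ ((eps k ^ 2 / (2 * σ k) : ℝ) : EReal)

/-- Stopping criterion (S1). -/
def StopS1 {p n : ℕ} (A : Matrix (Fin p) (Fin n) ℝ) (I : Finset (Fin p × Fin p)) (lam : ℝ)
    (σ : ℕ → ℝ) (w : ℕ → DualSp n I) (x : ℕ → Vec I) (θ : ℕ → ℝ) : Prop :=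
  (∀ k, 0 ≤ θ k) ∧ Summable θ ∧
    ∀ k, subGap A I lam σ w x k ≤
      ((θ k ^ 2 / (2 * σ k) * ‖x (k + 1) - x k‖ ^ 2 : ℝ) : EReal)

/-- Stopping criterion (S2).  The distance is `ℝ≥0∞`-valued, `+∞` for an empty set. -/
def StopS2 {p n : ℕ} (A : Matrix (Fin p) (Fin n) ℝ) (I : Finset (Fin p × Fin p)) (lam : ℝ)
    (σ : ℕ → ℝ) (w : ℕ → DualSp n I) (x : ℕ → Vec I) (θ' : ℕ → ℝ) : Prop :=
  (∀ k, 0 ≤ θ' k) ∧ Tendsto θ' atTop (𝓝 0) ∧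
    ∀ k, Metric.infEDist 0 (subdiff (augLagr A I lam (σ k) (x k)) (w (k + 1))) ≤
      ENNReal.ofReal (θ' k / σ k * ‖x (k + 1) - x k‖)

/-- `ζ = (κ (θ + 1) (κ² + σ²)^{-1/2} + θ) (1 - θ)^{-1}`. -/
def zeta (κ sig th : ℝ) : ℝ := (κ * (th + 1) * (√(κ ^ 2 + sig ^ 2))⁻¹ + th) * (1 - th)⁻¹

/-- `ζ_∞ = κ (κ² + σ_∞²)^{-1/2}`, which is `0` for `σ_∞ = ∞`. -/
def zetaInf (κ : ℝ) (σinf : ENNReal) : ℝ :=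
  if σinf = ⊤ then 0 else κ * (√(κ ^ 2 + σinf.toReal ^ 2))⁻¹

/-- `ζ' = κ (1 + θ') / σ`. -/
def zeta' (κ sig th' : ℝ) : ℝ := κ * (1 + th') / sig

/-- `ζ'_∞ = κ / σ_∞`, which is `0` for `σ_∞ = ∞`. -/
def zetaInf' (κ : ℝ) (σinf : ENNReal) : ℝ :=
  if σinf = ⊤ then 0 else κ / σinf.toReal

end DTraceALM

end

noncomputable section

namespace DTraceALM

/-! ### Hoffman's error bound for systems of linear inequalities -/

/-- Finite sets `L ≤ U` of reals, both nearly compatible with `t`, are separated near `t`. -/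
theorem exists_separating_near (L U : Finset ℝ) (hLU : ∀ l ∈ L, ∀ u ∈ U, l ≤ u) (t δ : ℝ)
    (hδ : 0 ≤ δ) (hl : ∀ l ∈ L, l ≤ t + δ) (hu : ∀ u ∈ U, t - δ ≤ u) :
    ∃ t', (∀ l ∈ L, l ≤ t') ∧ (∀ u ∈ U, t' ≤ u) ∧ |t' - t| ≤ δ := by
  have hne : (insert (t - δ) L).Nonempty := Finset.insert_nonempty _ _
  refine ⟨(insert (t - δ) L).max' hne, fun l hlL => Finset.le_max' _ _ (by simp [hlL]), ?_, ?_⟩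
  · intro u huU
    refine Finset.max'_le _ _ _ fun y hy => ?_
    rcases Finset.mem_insert.1 hy with rfl | hy
    · exact hu u huU
    · exact hLU y hy u huU
  · have h1 : t - δ ≤ (insert (t - δ) L).max' hne := Finset.le_max' _ _ (by simp)
    have h2 : (insert (t - δ) L).max' hne ≤ t + δ := by
      refine Finset.max'_le _ _ _ fun y hy => ?_
      rcases Finset.mem_insert.1 hy with rfl | hy
      · linarith
      · exact hl y hy
    rw [abs_le]
    constructor <;> linarith

theorem dotProduct_le_add_of_abs_sub_le {n : ℕ} (a x y : Fin n → ℝ) (M c : ℝ) (hc : 0 ≤ c)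
    (hM : ∑ k, |a k| ≤ M) (h : ∀ k, |y k - x k| ≤ c) : a ⬝ᵥ y ≤ a ⬝ᵥ x + M * c := by
  have h1 : a ⬝ᵥ y - a ⬝ᵥ x ≤ ∑ k, |a k| * c := by
    rw [dotProduct, dotProduct, ← Finset.sum_sub_distrib]
    refine Finset.sum_le_sum fun k _ => ?_
    calc a k * y k - a k * x k = a k * (y k - x k) := by ring
      _ ≤ |a k * (y k - x k)| := le_abs_self _
      _ = |a k| * |y k - x k| := abs_mul _ _
      _ ≤ |a k| * c := by gcongr; exact h k
  rw [← Finset.sum_mul] at h1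
  nlinarith [mul_le_mul_of_nonneg_right hM hc]

/-- Hoffman's error bound in coordinates, with a constant that does not depend on the right-hand
side.  It is enough that all relaxations of the system are solvable. -/
theorem hoffman_coord (n : ℕ) : ∀ {ι : Type} [Fintype ι] (a : ι → Fin n → ℝ),
    ∃ c : ℝ, 0 ≤ c ∧ ∀ b : ι → ℝ, (∀ ε > 0, ∃ x, ∀ i, a i ⬝ᵥ x ≤ b i + ε) →
      ∀ (x : Fin n → ℝ) (ε : ℝ), 0 ≤ ε → (∀ i, a i ⬝ᵥ x ≤ b i + ε) →
        ∃ y, (∀ i, a i ⬝ᵥ y ≤ b i) ∧ ∀ k, |y k - x k| ≤ c * ε := by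
  induction n with
  | zero =>
    intro ι _ a
    refine ⟨0, le_rfl, fun b hb x ε _ _ => ⟨x, fun i => ?_, fun k => k.elim0⟩⟩
    refine le_of_forall_pos_le_add fun ε hε => ?_
    obtain ⟨y, hy⟩ := hb ε hε
    have := hy i
    rwa [Subsingleton.elim y x] at this
  | succ n ih =>
    intro ι _ a
    have hdot : ∀ i (x : Fin (n + 1) → ℝ),
        a i ⬝ᵥ x = a i 0 * x 0 + Fin.tail (a i) ⬝ᵥ Fin.tail x := by
      intro i x
      simp [dotProduct, Fin.sum_univ_succ, Fin.tail]
    set m₁ : ι × ι → ℝ := fun q =>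
      if 0 < a q.1 0 ∧ a q.2 0 < 0 then -a q.2 0 else if a q.1 0 = 0 then 1 else 0 with hm₁
    set m₂ : ι × ι → ℝ := fun q => if 0 < a q.1 0 ∧ a q.2 0 < 0 then a q.1 0 else 0 with hm₂
    have hm₁0 : ∀ q, 0 ≤ m₁ q := by
      intro q
      simp only [hm₁]
      split_ifs with h1 h2
      · linarith [h1.2]
      · exact zero_le_one
      · exact le_rfl
    have hm₂0 : ∀ q, 0 ≤ m₂ q := by
      intro q
      simp only [hm₂]
      split_ifs with h1
      · exact h1.1.le
      · exact le_rfl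
    have helim : ∀ q, m₁ q * a q.1 0 + m₂ q * a q.2 0 = 0 := by
      intro q
      simp only [hm₁, hm₂]
      split_ifs with h1 h2
      · ring
      · simp [h2]
      · simp
    obtain ⟨c, hc, hcb⟩ := ih (fun q : ι × ι =>
      m₁ q • Fin.tail (a q.1) + m₂ q • Fin.tail (a q.2))
    set K : ℝ := 1 + ∑ q, (m₁ q + m₂ q) with hK
    have hKq : ∀ q, m₁ q + m₂ q ≤ K := by
      intro q
      have := Finset.single_le_sum (f := fun q => m₁ q + m₂ q)
        (fun q _ => add_nonneg (hm₁0 q) (hm₂0 q)) (Finset.mem_univ q)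
      linarith
    have hK0 : 0 < K := by
      have : 0 ≤ ∑ q, (m₁ q + m₂ q) :=
        Finset.sum_nonneg fun q _ => add_nonneg (hm₁0 q) (hm₂0 q)
      linarith
    set M : ℝ := ∑ i, ∑ k, |Fin.tail (a i) k| with hM
    have hM0 : 0 ≤ M := Finset.sum_nonneg fun i _ => Finset.sum_nonneg fun k _ => abs_nonneg _
    have hMi : ∀ i, ∑ k, |Fin.tail (a i) k| ≤ M := fun i =>
      Finset.single_le_sum (f := fun i => ∑ k, |Fin.tail (a i) k|)
        (fun i _ => Finset.sum_nonneg fun k _ => abs_nonneg _) (Finset.mem_univ i)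
    set D : ℝ := ∑ i, |a i 0|⁻¹ with hD
    have hD0 : 0 ≤ D := Finset.sum_nonneg fun i _ => inv_nonneg.2 (abs_nonneg _)
    have hDi : ∀ i, |a i 0|⁻¹ ≤ D := fun i =>
      Finset.single_le_sum (f := fun i => |a i 0|⁻¹)
        (fun i _ => inv_nonneg.2 (abs_nonneg _)) (Finset.mem_univ i)
    have hproj : ∀ (b : ι → ℝ) (x : Fin (n + 1) → ℝ) (ε : ℝ), 0 ≤ ε →
        (∀ i, a i ⬝ᵥ x ≤ b i + ε) → ∀ q : ι × ι,
        (m₁ q • Fin.tail (a q.1) + m₂ q • Fin.tail (a q.2)) ⬝ᵥ Fin.tail x ≤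
          (m₁ q * b q.1 + m₂ q * b q.2) + K * ε := by
      intro b x ε hε hx q
      have h1 := mul_le_mul_of_nonneg_left (hx q.1) (hm₁0 q)
      have h2 := mul_le_mul_of_nonneg_left (hx q.2) (hm₂0 q)
      rw [hdot] at h1 h2
      rw [add_dotProduct, smul_dotProduct, smul_dotProduct, smul_eq_mul, smul_eq_mul]
      have h3 := helim q
      have h4 := mul_le_mul_of_nonneg_right (hKq q) hε
      have h5 : m₁ q * (a q.1 0 * x 0) + m₂ q * (a q.2 0 * x 0) = 0 := by
        rw [← zero_mul (x 0), ← h3]; ring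
      linarith
    set B : ℝ := 1 + M * (c * K) with hB
    have hB0 : 0 ≤ B := by positivity
    refine ⟨B * D + c * K, by positivity, fun b hb x ε hε hx => ?_⟩
    obtain ⟨y, hy, hyx⟩ := hcb (fun q => m₁ q * b q.1 + m₂ q * b q.2) (by
      intro η hη
      obtain ⟨z, hz⟩ := hb (η / K) (by positivity)
      refine ⟨Fin.tail z, fun q => ?_⟩
      have := hproj b z (η / K) (by positivity) hz q
      rwa [mul_div_cancel₀ _ hK0.ne'] at this) (Fin.tail x) (K * ε) (by positivity)
      (hproj b x ε hε hx)
    have hnear : ∀ i, a i 0 * x 0 ≤ b i - Fin.tail (a i) ⬝ᵥ y + B * ε := by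
      intro i
      have h1 := hx i
      rw [hdot] at h1
      have h2 := dotProduct_le_add_of_abs_sub_le (Fin.tail (a i)) (Fin.tail x) y M (c * (K * ε))
        (by positivity) (hMi i) hyx
      have h3 : B * ε = ε + M * (c * (K * ε)) := by rw [hB]; ring
      linarith
    classical
    obtain ⟨t, htL, htU, htx⟩ := exists_separating_near
      ((Finset.univ.filter fun i => a i 0 < 0).image
        fun i => (b i - Fin.tail (a i) ⬝ᵥ y) / a i 0)
      ((Finset.univ.filter fun i => 0 < a i 0).image
        fun i => (b i - Fin.tail (a i) ⬝ᵥ y) / a i 0) (by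
        simp only [Finset.mem_image, Finset.mem_filter, Finset.mem_univ, true_and]
        rintro _ ⟨j, hj, rfl⟩ _ ⟨i, hi, rfl⟩
        have h := hy (i, j)
        have e1 : m₁ (i, j) = -a j 0 := by simp [hm₁, hi, hj]
        have e2 : m₂ (i, j) = a i 0 := by simp [hm₂, hi, hj]
        rw [add_dotProduct, smul_dotProduct, smul_dotProduct, smul_eq_mul, smul_eq_mul, e1, e2] at h
        rw [div_le_iff_of_neg hj, div_mul_eq_mul_div, div_le_iff₀ hi]
        simp only at h
        linarith) (x 0) (B * D * ε) (by positivity) (by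
        simp only [Finset.mem_image, Finset.mem_filter, Finset.mem_univ, true_and]
        rintro _ ⟨j, hj, rfl⟩
        rw [div_le_iff_of_neg hj]
        have h1 := hnear j
        have h2 : 1 ≤ D * (-a j 0) := by
          have := mul_le_mul_of_nonneg_right (hDi j) (abs_nonneg (a j 0))
          rw [inv_mul_cancel₀ (abs_ne_zero.2 hj.ne), abs_of_neg hj] at this
          exact this
        have h3 := mul_le_mul_of_nonneg_left h2 (mul_nonneg hB0 hε)
        nlinarith) (by
        simp only [Finset.mem_image, Finset.mem_filter, Finset.mem_univ, true_and]
        rintro _ ⟨j, hj, rfl⟩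
        rw [le_div_iff₀ hj]
        have h1 := hnear j
        have h2 : 1 ≤ D * a j 0 := by
          have := mul_le_mul_of_nonneg_right (hDi j) (abs_nonneg (a j 0))
          rw [inv_mul_cancel₀ (abs_ne_zero.2 hj.ne'), abs_of_pos hj] at this
          exact this
        have h3 := mul_le_mul_of_nonneg_left h2 (mul_nonneg hB0 hε)
        nlinarith)
    refine ⟨Fin.cons t y, fun i => ?_, fun k => ?_⟩
    · rw [hdot, Fin.cons_zero, Fin.tail_cons]
      rcases lt_trichotomy (a i 0) 0 with hi | hi | hi
      · have := htL _ (Finset.mem_image_of_mem _ (by simp [hi] : i ∈ _))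
        rw [div_le_iff_of_neg hi] at this
        linarith
      · have h := hy (i, i)
        have e1 : m₁ (i, i) = 1 := by simp [hm₁, hi]
        have e2 : m₂ (i, i) = 0 := by simp [hm₂, hi]
        rw [e1, e2] at h
        simp only [one_smul, zero_smul, add_zero, one_mul, zero_mul] at h
        rw [hi]
        linarith
      · have := htU _ (Finset.mem_image_of_mem _ (by simp [hi] : i ∈ _))
        rw [le_div_iff₀ hi] at this
        linarith
    · have hcK : 0 ≤ c * K * ε := by positivity
      have hBD : 0 ≤ B * D * ε := by positivity
      refine Fin.cases ?_ (fun k => ?_) k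
      · rw [Fin.cons_zero]
        linarith
      · rw [Fin.cons_succ]
        have := hyx k
        simp only [Fin.tail] at this
        linarith

/-- Local error bound for a system of linear inequalities: an almost solution is close to a
solution. -/
theorem exists_solution_near {E : Type*} [NormedAddCommGroup E] [NormedSpace ℝ E]
    [FiniteDimensional ℝ E] {ι : Type} [Fintype ι] (f : ι → E →ₗ[ℝ] ℝ) (b : ι → ℝ) :
    ∃ c : ℝ, 0 ≤ c ∧ ∃ δ : ℝ, 0 < δ ∧ ∀ (x : E) (ε : ℝ), 0 ≤ ε → ε < δ →
      (∀ i, f i x ≤ b i + ε) → ∃ y, (∀ i, f i y ≤ b i) ∧ ‖y - x‖ ≤ c * ε := by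
  set n := Module.finrank ℝ E
  let B : Module.Basis (Fin n) ℝ E := Module.finBasis ℝ E
  let a : ι → Fin n → ℝ := fun i k => f i (B k)
  have ha : ∀ i x, f i x = a i ⬝ᵥ (B.repr x) := by
    intro i x
    conv_lhs => rw [← B.sum_repr x, map_sum]
    simp only [map_smul, smul_eq_mul, dotProduct, a, mul_comm]
  have ha' : ∀ i (y : Fin n → ℝ), f i (∑ k, y k • B k) = a i ⬝ᵥ y := by
    intro i y
    simp [dotProduct, a, mul_comm (y _)]
  obtain ⟨c, hc, h⟩ := hoffman_coord n a
  refine ⟨c * ∑ k, ‖B k‖, by positivity, ?_⟩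
  by_cases hb : ∀ ε > 0, ∃ x, ∀ i, a i ⬝ᵥ x ≤ b i + ε
  · refine ⟨1, one_pos, fun x ε hε _ hx => ?_⟩
    obtain ⟨y, hy, hyx⟩ := h b hb (B.repr x) ε hε fun i => (ha i x) ▸ hx i
    refine ⟨∑ k, y k • B k, fun i => (ha' i y).le.trans (hy i), ?_⟩
    conv_lhs => rw [← B.sum_repr x]
    rw [← Finset.sum_sub_distrib]
    refine (norm_sum_le _ _).trans ?_
    rw [mul_right_comm, Finset.mul_sum]
    refine Finset.sum_le_sum fun k _ => ?_
    rw [← sub_smul, norm_smul, Real.norm_eq_abs]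
    exact mul_le_mul_of_nonneg_right (hyx k) (norm_nonneg _)
  · push Not at hb
    obtain ⟨δ, hδ, hδb⟩ := hb
    refine ⟨δ, hδ, fun x ε _ hεδ hx => ?_⟩
    obtain ⟨i, hi⟩ := hδb (B.repr x)
    rw [← ha] at hi
    linarith [hx i]

/-! ### Subgradients of convex functions with quadratic slack -/

/-- A subgradient inequality that holds up to a quadratic error holds exactly. -/
theorem subgradient_of_quadratic_slack {E : Type*} [NormedAddCommGroup E] [InnerProductSpace ℝ E]
    {C : Set E} {f : E → ℝ} (hf : ConvexOn ℝ C f) {x v : E} (hx : x ∈ C) {c : ℝ}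
    (h : ∀ y ∈ C, f x + inner ℝ v (y - x) - c * ‖y - x‖ ^ 2 ≤ f y) :
    ∀ y ∈ C, f x + inner ℝ v (y - x) ≤ f y := by
  intro y hy
  have key : ∀ t : ℝ, 0 < t → t ≤ 1 → f x + inner ℝ v (y - x) - t * (c * ‖y - x‖ ^ 2) ≤ f y := by
    intro t ht ht1
    have h1 := h _ (hf.1 hx hy (by linarith : (0 : ℝ) ≤ 1 - t) ht.le (by ring))
    have h2 := hf.2 hx hy (by linarith : (0 : ℝ) ≤ 1 - t) ht.le (by ring)
    have h3 : (1 - t) • x + t • y - x = t • (y - x) := by module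
    rw [h3, inner_smul_right, norm_smul, mul_pow, Real.norm_eq_abs, sq_abs] at h1
    simp only [smul_eq_mul] at h2
    have h4 : t * (f x + inner ℝ v (y - x) - t * (c * ‖y - x‖ ^ 2)) ≤ t * f y := by nlinarith
    exact le_of_mul_le_mul_left h4 ht
  have hlim : Tendsto (fun t : ℝ => f x + inner ℝ v (y - x) - t * (c * ‖y - x‖ ^ 2)) (𝓝[>] 0)
      (𝓝 (f x + inner ℝ v (y - x) - 0 * (c * ‖y - x‖ ^ 2))) :=
    (Continuous.tendsto (by fun_prop) 0).mono_left nhdsWithin_le_nhds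
  rw [zero_mul, sub_zero] at hlim
  refine le_of_tendsto hlim ?_
  filter_upwards [Ioc_mem_nhdsGT (zero_lt_one' ℝ)] with t ht
  exact key t ht.1 ht.2

/-! ### Weights and complementarity -/

variable {p n : ℕ}

/-- The weights of the `ℓ₁` term of `Γ`. -/
def wt (I : Finset (Fin p × Fin p)) (lam : ℝ) (i : Idx I) : ℝ := lam / 2 * |e2 I i|

theorem wt_nonneg (I : Finset (Fin p × Fin p)) {lam : ℝ} (hlam : 0 < lam) (i : Idx I) :
    0 ≤ wt I lam i := by
  unfold wt
  positivity

theorem e1_apply (I : Finset (Fin p × Fin p)) (i : Idx I) :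
    e1 I i = if i.1.1 = i.1.2 then 1 else 0 :=
  Matrix.one_apply

theorem e2_apply (I : Finset (Fin p × Fin p)) (i : Idx I) :
    e2 I i = if i.1.1 = i.1.2 then 0 else 2 := by
  change 2 * (1 - (1 : Matrix (Fin p) (Fin p) ℝ) i.1.1 i.1.2) = _
  rw [Matrix.one_apply]
  split_ifs <;> norm_num

theorem mem_bset_iff (I : Finset (Fin p × Fin p)) {lam : ℝ} (hlam : 0 < lam) (z : Vec I) :
    z ∈ bset I lam ↔ ∀ i, |z i| ≤ wt I lam i := by
  refine forall_congr' fun i => ?_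
  rw [wt, e1_apply, e2_apply]
  split_ifs with h
  · rw [one_mul, abs_zero, mul_zero, abs_nonpos_iff]
    refine ⟨And.left, fun h => ⟨h, ?_⟩⟩
    rw [h, abs_zero]
    exact hlam.le
  · rw [zero_mul, abs_two, div_mul_cancel₀ _ two_ne_zero]
    exact and_iff_right rfl

/-- `z` is a subgradient at `x` of the weighted `ℓ₁` norm. -/
def SignCompl (I : Finset (Fin p × Fin p)) (lam : ℝ) (x z : Vec I) : Prop :=
  ∀ i, |z i| ≤ wt I lam i ∧ z i * x i = wt I lam i * |x i|

/-- The weighted `ℓ₁` norm. -/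
def wl1 (I : Finset (Fin p × Fin p)) (lam : ℝ) (x : Vec I) : ℝ := ∑ i, wt I lam i * |x i|

theorem Gam_eq (A : Matrix (Fin p) (Fin n) ℝ) (I : Finset (Fin p × Fin p)) (lam : ℝ)
    (x : Vec I) :
    Gam A I lam x = 1 / 2 * ‖opSadj A I x‖ ^ 2 - inner ℝ x (e1 I) + wl1 I lam x := by
  unfold Gam wl1 wt
  rw [Finset.mul_sum]
  congr 1
  refine Finset.sum_congr rfl fun i _ => ?_
  rw [abs_mul]
  ring

theorem vec_inner (I : Finset (Fin p × Fin p)) (z x : Vec I) :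
    inner ℝ z x = ∑ i, z i * x i := by
  simp [PiLp.inner_apply, mul_comm]

theorem convexOn_wl1 (I : Finset (Fin p × Fin p)) {lam : ℝ} (hlam : 0 < lam) :
    ConvexOn ℝ Set.univ (wl1 I lam) := by
  refine ⟨convex_univ, fun x _ y _ a b ha hb _ => ?_⟩
  simp only [wl1, smul_eq_mul, Finset.mul_sum, ← Finset.sum_add_distrib]
  refine Finset.sum_le_sum fun i _ => ?_
  have h1 : |a * x i + b * y i| ≤ a * |x i| + b * |y i| := by
    refine (abs_add_le _ _).trans ?_
    rw [abs_mul, abs_mul, abs_of_nonneg ha, abs_of_nonneg hb]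
  have h2 := mul_le_mul_of_nonneg_left h1 (wt_nonneg I hlam i)
  simp only [PiLp.add_apply, PiLp.smul_apply, smul_eq_mul]
  linarith

theorem mul_le_wt_mul_abs (I : Finset (Fin p × Fin p)) {lam : ℝ} {z : Vec I} (x : Vec I)
    {i : Idx I} (hz : |z i| ≤ wt I lam i) : z i * x i ≤ wt I lam i * |x i| := by
  refine (le_abs_self _).trans ?_
  rw [abs_mul]
  exact mul_le_mul_of_nonneg_right hz (abs_nonneg _)

theorem signCompl_of_forall_bset (I : Finset (Fin p × Fin p)) {lam : ℝ} (hlam : 0 < lam)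
    {x z : Vec I} (hz : z ∈ bset I lam)
    (h : ∀ z' ∈ bset I lam, inner ℝ x (z' - z) ≤ 0) : SignCompl I lam x z := by
  have hz' := (mem_bset_iff I hlam z).1 hz
  set s : Vec I := WithLp.toLp 2 fun i => wt I lam i * (SignType.sign (x i) : ℝ) with hs
  have hsb : s ∈ bset I lam := by
    rw [mem_bset_iff I hlam]
    intro i
    simp only [hs, abs_mul, abs_of_nonneg (wt_nonneg I hlam i)]
    refine mul_le_of_le_one_right (wt_nonneg I hlam i) ?_
    rcases SignType.sign (x i) with _ | _ | _ <;> simp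
  have h1 := h s hsb
  rw [vec_inner] at h1
  have hterm : ∀ i, x i * (s - z) i = wt I lam i * |x i| - z i * x i := by
    intro i
    simp only [hs, PiLp.sub_apply]
    rw [← self_mul_sign (x i)]
    ring
  simp only [hterm] at h1
  have hnn : ∀ i ∈ Finset.univ, 0 ≤ wt I lam i * |x i| - z i * x i := fun i _ =>
    sub_nonneg.2 (mul_le_wt_mul_abs I x (hz' i))
  have h0 := (Finset.sum_eq_zero_iff_of_nonneg hnn).1 (le_antisymm h1 (Finset.sum_nonneg hnn))
  exact fun i => ⟨hz' i, by linarith [h0 i (Finset.mem_univ i)]⟩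

namespace SignCompl

variable {I : Finset (Fin p × Fin p)} {lam : ℝ} {x z : Vec I}

theorem mem_bset (hlam : 0 < lam) (h : SignCompl I lam x z) : z ∈ bset I lam :=
  (mem_bset_iff I hlam z).2 fun i => (h i).1

theorem inner_sub_nonpos (hlam : 0 < lam) (h : SignCompl I lam x z) {z' : Vec I}
    (hz' : z' ∈ bset I lam) : inner ℝ x (z' - z) ≤ 0 := by
  rw [vec_inner]
  refine Finset.sum_nonpos fun i _ => ?_
  have h1 := mul_le_wt_mul_abs I x ((mem_bset_iff I hlam z').1 hz' i)
  have h2 := (h i).2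
  simp only [PiLp.sub_apply]
  linarith

theorem subgradient (h : SignCompl I lam x z) (y : Vec I) :
    wl1 I lam x + inner ℝ z (y - x) ≤ wl1 I lam y := by
  rw [vec_inner, wl1, wl1, ← Finset.sum_add_distrib]
  refine Finset.sum_le_sum fun i _ => ?_
  have h1 := mul_le_wt_mul_abs I y (h i).1
  have h2 := (h i).2
  simp only [PiLp.sub_apply]
  linarith

theorem of_subgradient
    (h : ∀ y, wl1 I lam x + inner ℝ z (y - x) ≤ wl1 I lam y) : SignCompl I lam x z := by
  have hscal : ∀ (c : ℝ), 0 ≤ c → wl1 I lam (c • x) = c * wl1 I lam x := by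
    intro c hc
    simp only [wl1, Finset.mul_sum, PiLp.smul_apply, smul_eq_mul, abs_mul, abs_of_nonneg hc]
    exact Finset.sum_congr rfl fun i _ => by ring
  have hle : wl1 I lam x ≤ inner ℝ z x := by
    have := h ((0 : ℝ) • x)
    rw [hscal 0 le_rfl, zero_smul, zero_sub, inner_neg_right] at this
    linarith
  have hge : inner ℝ z x ≤ wl1 I lam x := by
    have := h ((2 : ℝ) • x)
    rw [hscal 2 zero_le_two, two_smul, add_sub_cancel_right] at this
    linarith
  have hz : ∀ i, |z i| ≤ wt I lam i := by
    intro i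
    have hs : ∀ s : ℝ, |s| = 1 → z i * s ≤ wt I lam i := by
      intro s hs
      have h1 := h (EuclideanSpace.single i s)
      rw [inner_sub_right, vec_inner I z (EuclideanSpace.single i s)] at h1
      have h2 : ∑ j, z j * (EuclideanSpace.single i s : Vec I) j = z i * s := by
        rw [Finset.sum_eq_single i] <;> simp +contextual
      have h3 : wl1 I lam (EuclideanSpace.single i s) = wt I lam i := by
        rw [wl1, Finset.sum_eq_single i] <;> simp +contextual [hs]
      rw [h2, h3] at h1
      linarith
    rw [abs_le]
    have h1 := hs 1 (by simp)
    have h2 := hs (-1) (by simp)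
    constructor <;> linarith
  have hnn : ∀ i ∈ Finset.univ, 0 ≤ wt I lam i * |x i| - z i * x i := fun i _ =>
    sub_nonneg.2 (mul_le_wt_mul_abs I x (hz i))
  have hsum : ∑ i, (wt I lam i * |x i| - z i * x i) = 0 := by
    rw [Finset.sum_sub_distrib, ← vec_inner]
    change wl1 I lam x - inner ℝ z x = 0
    linarith
  have h0 := (Finset.sum_eq_zero_iff_of_nonneg hnn).1 hsum
  exact fun i => ⟨hz i, by linarith [h0 i (Finset.mem_univ i)]⟩

end SignCompl

/-! ### The subdifferential of `Γ` and the solution set -/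

theorem inner_opSadj (A : Matrix (Fin p) (Fin n) ℝ) (I : Finset (Fin p × Fin p)) (x : Vec I)
    (Y : FMat p n) : inner ℝ (opSadj A I x) Y = inner ℝ x (opS A I Y) :=
  LinearMap.adjoint_inner_left _ _ _

theorem inner_opSadj_right (A : Matrix (Fin p) (Fin n) ℝ) (I : Finset (Fin p × Fin p)) (x : Vec I)
    (Y : FMat p n) : inner ℝ Y (opSadj A I x) = inner ℝ (opS A I Y) x :=
  LinearMap.adjoint_inner_right _ _ _

theorem exists_norm_le_of_linearMap {E F : Type*} [NormedAddCommGroup E] [NormedSpace ℝ E]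
    [FiniteDimensional ℝ E] [NormedAddCommGroup F] [NormedSpace ℝ F] (f : E →ₗ[ℝ] F) :
    ∃ c : ℝ, 0 ≤ c ∧ ∀ x, ‖f x‖ ≤ c * ‖x‖ :=
  ⟨‖LinearMap.toContinuousLinearMap f‖, norm_nonneg _,
    (LinearMap.toContinuousLinearMap f).le_opNorm⟩

/-- The dual slack that goes with `x` and a subgradient `v` of `Γ` at `x`. -/
def slack (A : Matrix (Fin p) (Fin n) ℝ) (I : Finset (Fin p × Fin p)) (x v : Vec I) : Vec I :=
  v + e1 I - opS A I (opSadj A I x)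

theorem Gam_expand (A : Matrix (Fin p) (Fin n) ℝ) (I : Finset (Fin p × Fin p)) (lam : ℝ)
    (x v y : Vec I) :
    Gam A I lam y = Gam A I lam x + inner ℝ v (y - x) + 1 / 2 * ‖opSadj A I (y - x)‖ ^ 2 +
      (wl1 I lam y - (wl1 I lam x + inner ℝ (slack A I x v) (y - x))) := by
  have h1 : opSadj A I y = opSadj A I x + opSadj A I (y - x) := by
    rw [← map_add, add_sub_cancel]
  have h2 : inner ℝ (opS A I (opSadj A I x)) (y - x) =
      inner ℝ (opSadj A I x) (opSadj A I (y - x)) := by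
    rw [inner_opSadj_right]
  rw [Gam_eq, Gam_eq, h1, norm_add_sq_real, slack, inner_sub_left, inner_add_left, h2,
    ← real_inner_comm y (e1 I), ← real_inner_comm x (e1 I), inner_sub_right (e1 I)]
  ring

theorem signCompl_of_Gam_slack (A : Matrix (Fin p) (Fin n) ℝ) (I : Finset (Fin p × Fin p))
    {lam : ℝ} (hlam : 0 < lam) {x v : Vec I} {c : ℝ}
    (h : ∀ y, Gam A I lam x + inner ℝ v (y - x) - c * ‖y - x‖ ^ 2 ≤ Gam A I lam y) :
    SignCompl I lam x (slack A I x v) := by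
  obtain ⟨K, hK, hKb⟩ := exists_norm_le_of_linearMap (opSadj A I)
  refine SignCompl.of_subgradient fun y => ?_
  refine subgradient_of_quadratic_slack (convexOn_wl1 I hlam) (Set.mem_univ x)
    (c := c + 1 / 2 * K ^ 2) (fun y _ => ?_) y (Set.mem_univ y)
  have h1 := h y
  rw [Gam_expand A I lam x v y] at h1
  have h2 : ‖opSadj A I (y - x)‖ ^ 2 ≤ K ^ 2 * ‖y - x‖ ^ 2 := by
    rw [← mul_pow]
    exact pow_le_pow_left₀ (norm_nonneg _) (hKb _) 2
  linarith

theorem SignCompl.Gam_subgradient {A : Matrix (Fin p) (Fin n) ℝ} {I : Finset (Fin p × Fin p)}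
    {lam : ℝ} {x v : Vec I} (h : SignCompl I lam x (slack A I x v)) (y : Vec I) :
    Gam A I lam x + inner ℝ v (y - x) ≤ Gam A I lam y := by
  have h1 := h.subgradient y
  rw [Gam_expand A I lam x v y]
  have : 0 ≤ ‖opSadj A I (y - x)‖ ^ 2 := by positivity
  linarith

theorem mem_TGam_iff (A : Matrix (Fin p) (Fin n) ℝ) (I : Finset (Fin p × Fin p))
    {lam : ℝ} (hlam : 0 < lam) (x v : Vec I) :
    v ∈ TGam A I lam x ↔ SignCompl I lam x (slack A I x v) := by
  simp only [TGam, subdiff, Set.mem_ofPred_eq]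
  norm_cast
  constructor
  · intro h
    exact signCompl_of_Gam_slack A I hlam (c := 0) fun y => by simpa using h y
  · exact fun h y => h.Gam_subgradient y

theorem mem_primalSolutions_iff_le (A : Matrix (Fin p) (Fin n) ℝ) (I : Finset (Fin p × Fin p))
    (lam : ℝ) (x : Vec I) :
    x ∈ primalSolutions A I lam ↔ ∀ y, Gam A I lam x ≤ Gam A I lam y := by
  simp [primalSolutions, IsMaxOn, IsMaxFilter]

theorem zeros_TGam (A : Matrix (Fin p) (Fin n) ℝ) (I : Finset (Fin p × Fin p)) (lam : ℝ) :
    zeros (TGam A I lam) = primalSolutions A I lam := by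
  ext x
  rw [mem_primalSolutions_iff_le]
  simp only [zeros, TGam, subdiff, Set.mem_ofPred_eq, inner_zero_left]
  norm_cast
  simp

theorem mem_primalSolutions_iff (A : Matrix (Fin p) (Fin n) ℝ) (I : Finset (Fin p × Fin p))
    {lam : ℝ} (hlam : 0 < lam) (x : Vec I) :
    x ∈ primalSolutions A I lam ↔ SignCompl I lam x (slack A I x 0) := by
  rw [← zeros_TGam, ← mem_TGam_iff A I hlam]
  rfl

theorem continuous_Gam (A : Matrix (Fin p) (Fin n) ℝ) (I : Finset (Fin p × Fin p)) (lam : ℝ) :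
    Continuous (Gam A I lam) := by
  have : Continuous (opSadj A I) := LinearMap.continuous_of_finiteDimensional _
  unfold Gam
  fun_prop

theorem isClosed_primalSolutions (A : Matrix (Fin p) (Fin n) ℝ) (I : Finset (Fin p × Fin p))
    (lam : ℝ) : IsClosed (primalSolutions A I lam) := by
  have : primalSolutions A I lam = ⋂ y, {x | Gam A I lam x ≤ Gam A I lam y} := by
    ext x
    simp [mem_primalSolutions_iff_le]
  rw [this]
  exact isClosed_iInter fun y => isClosed_le (continuous_Gam A I lam) continuous_const

/-! ### The Lagrangian and its subdifferential -/

/-- The finite values of the Lagrangian. -/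
def lagrReal (A : Matrix (Fin p) (Fin n) ℝ) (I : Finset (Fin p × Fin p)) (w : DualSp n I)
    (x : Vec I) : ℝ :=
  1 / 2 * ‖w.fst‖ ^ 2 - inner ℝ (resid A I w) x

theorem dualObj_of_mem {I : Finset (Fin p × Fin p)} {lam : ℝ} {w : DualSp n I}
    (hw : w.snd ∈ bset I lam) : dualObj I lam w = ((1 / 2 * ‖w.fst‖ ^ 2 : ℝ) : EReal) := by
  simp [dualObj, indicatorFn, hw]

theorem dualObj_of_notMem {I : Finset (Fin p × Fin p)} {lam : ℝ} {w : DualSp n I}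
    (hw : w.snd ∉ bset I lam) : dualObj I lam w = ⊤ := by
  rw [dualObj, indicatorFn, if_neg hw, EReal.coe_add_top]

theorem lagr_of_mem (A : Matrix (Fin p) (Fin n) ℝ) {I : Finset (Fin p × Fin p)} {lam : ℝ}
    {w : DualSp n I} (hw : w.snd ∈ bset I lam) (x : Vec I) :
    lagr A I lam w x = (lagrReal A I w x : EReal) := by
  rw [lagr, dualObj_of_mem hw, ← EReal.coe_add, lagrReal, sub_eq_add_neg]

theorem lagr_of_notMem (A : Matrix (Fin p) (Fin n) ℝ) {I : Finset (Fin p × Fin p)} {lam : ℝ}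
    {w : DualSp n I} (hw : w.snd ∉ bset I lam) (x : Vec I) : lagr A I lam w x = ⊤ := by
  rw [lagr, dualObj_of_notMem hw, EReal.top_add_coe]

theorem augLagr_of_mem (A : Matrix (Fin p) (Fin n) ℝ) {I : Finset (Fin p × Fin p)}
    {lam : ℝ} (sig : ℝ) {w : DualSp n I} (hw : w.snd ∈ bset I lam) (x : Vec I) :
    augLagr A I lam sig x w =
      ((lagrReal A I w x + sig / 2 * ‖resid A I w‖ ^ 2 : ℝ) : EReal) := by
  rw [augLagr, lagr_of_mem A hw, EReal.coe_add]

theorem augLagr_of_notMem (A : Matrix (Fin p) (Fin n) ℝ) {I : Finset (Fin p × Fin p)}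
    {lam : ℝ} (sig : ℝ) {w : DualSp n I} (hw : w.snd ∉ bset I lam) (x : Vec I) :
    augLagr A I lam sig x w = ⊤ := by
  rw [augLagr, lagr_of_notMem A hw, EReal.top_add_coe]

theorem zero_mem_bset (I : Finset (Fin p × Fin p)) {lam : ℝ} (hlam : 0 < lam) :
    (0 : Vec I) ∈ bset I lam := by
  intro i
  simp [hlam.le]

theorem resid_sub (A : Matrix (Fin p) (Fin n) ℝ) (I : Finset (Fin p × Fin p))
    (w w' : DualSp n I) :
    resid A I w' - resid A I w = opS A I (w'.fst - w.fst) + (w'.snd - w.snd) := by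
  rw [resid, resid, map_sub]
  abel

theorem lagrReal_expand (A : Matrix (Fin p) (Fin n) ℝ) (I : Finset (Fin p × Fin p))
    (w w' : DualSp n I) (x : Vec I) :
    lagrReal A I w' x = lagrReal A I w x + inner ℝ (w.fst - opSadj A I x) (w'.fst - w.fst) -
      inner ℝ x (w'.snd - w.snd) + 1 / 2 * ‖w'.fst - w.fst‖ ^ 2 := by
  have h1 : resid A I w' = resid A I w + (opS A I (w'.fst - w.fst) + (w'.snd - w.snd)) := by
    rw [← resid_sub]
    abel
  have h2 : ‖w'.fst‖ ^ 2 = ‖w.fst‖ ^ 2 + 2 * inner ℝ w.fst (w'.fst - w.fst) +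
      ‖w'.fst - w.fst‖ ^ 2 := by
    rw [← norm_add_sq_real, add_sub_cancel]
  rw [lagrReal, lagrReal, h1, h2, inner_add_left, inner_add_left, inner_sub_left w.fst,
    inner_opSadj, real_inner_comm x (opS A I _), real_inner_comm x (w'.snd - w.snd)]
  ring

theorem bset_convex (I : Finset (Fin p × Fin p)) {lam : ℝ} (hlam : 0 < lam) :
    Convex ℝ (bset I lam) := by
  intro z hz z' hz' a b ha hb hab
  rw [mem_bset_iff I hlam] at *
  intro i
  have h1 := mul_le_mul_of_nonneg_left (hz i) ha
  have h2 := mul_le_mul_of_nonneg_left (hz' i) hb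
  have h3 : |a * z i + b * z' i| ≤ a * |z i| + b * |z' i| := by
    refine (abs_add_le _ _).trans ?_
    rw [abs_mul, abs_mul, abs_of_nonneg ha, abs_of_nonneg hb]
  have h4 : a * wt I lam i + b * wt I lam i = wt I lam i := by rw [← add_mul, hab, one_mul]
  simp only [PiLp.add_apply, PiLp.smul_apply, smul_eq_mul]
  linarith

/-- First-order optimality in `(Y, z)`, from an inequality with quadratic slack. -/
theorem optimality_of_slack (A : Matrix (Fin p) (Fin n) ℝ) (I : Finset (Fin p × Fin p))
    {lam : ℝ} (hlam : 0 < lam) {w v : DualSp n I} {x : Vec I} (hw : w.snd ∈ bset I lam) {c : ℝ}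
    (h : ∀ w' : DualSp n I, w'.snd ∈ bset I lam →
      lagrReal A I w x + inner ℝ v (w' - w) - c * ‖w' - w‖ ^ 2 ≤ lagrReal A I w' x) :
    v.fst = w.fst - opSadj A I x ∧ SignCompl I lam (v.snd + x) w.snd := by
  set C : Set (DualSp n I) := {w | w.snd ∈ bset I lam} with hC
  have hCc : Convex ℝ C := fun w hw w' hw' a b ha hb hab => bset_convex I hlam hw hw' ha hb hab
  have key := subgradient_of_quadratic_slack (C := C) (f := fun _ => (0 : ℝ))
    (v := WithLp.toLp 2 (v.fst - (w.fst - opSadj A I x), v.snd + x)) (c := c + 1 / 2)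
    (convexOn_const 0 hCc) (x := w) hw (fun w' hw' => by
      have h1 := h w' hw'
      rw [lagrReal_expand A I w w' x, WithLp.prod_inner_apply] at h1
      have h2 : ‖w' - w‖ ^ 2 = ‖w'.fst - w.fst‖ ^ 2 + ‖w'.snd - w.snd‖ ^ 2 :=
        WithLp.prod_norm_sq_eq_of_L2 _
      have h3 : 0 ≤ ‖w'.snd - w.snd‖ ^ 2 := by positivity
      rw [WithLp.prod_inner_apply]
      simp only [WithLp.ofLp_fst, WithLp.ofLp_snd, WithLp.sub_fst, WithLp.sub_snd] at h1 ⊢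
      rw [inner_sub_left v.fst, inner_add_left v.snd]
      linarith)
  simp only [zero_add] at key
  constructor
  · set D := v.fst - (w.fst - opSadj A I x) with hD
    have h1 := key (WithLp.toLp 2 (w.fst + D, w.snd)) hw
    rw [WithLp.prod_inner_apply] at h1
    simp only [WithLp.ofLp_fst, WithLp.ofLp_snd, WithLp.sub_fst, WithLp.sub_snd,
        WithLp.toLp_fst, WithLp.toLp_snd, add_sub_cancel_left, sub_self, inner_zero_right,
        add_zero] at h1
    exact sub_eq_zero.1 (real_inner_self_nonpos.1 h1)
  · refine signCompl_of_forall_bset I hlam hw fun z' hz' => ?_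
    have h1 := key (WithLp.toLp 2 (w.fst, z')) hz'
    rw [WithLp.prod_inner_apply] at h1
    simpa only [WithLp.ofLp_fst, WithLp.ofLp_snd, WithLp.sub_fst, WithLp.sub_snd,
        WithLp.toLp_fst, WithLp.toLp_snd, sub_self, inner_zero_right, zero_add] using h1

theorem snd_mem_bset_of_subdiff {I : Finset (Fin p × Fin p)} {lam : ℝ} (hlam : 0 < lam)
    {f : DualSp n I → EReal} {w v : DualSp n I} (htop : ∀ w, w.snd ∉ bset I lam → f w = ⊤)
    (hfin : ∀ w, w.snd ∈ bset I lam → f w ≠ ⊤) (h : v ∈ subdiff f w) : w.snd ∈ bset I lam := by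
  by_contra hw
  have h1 := h 0
  rw [htop w hw, EReal.top_add_coe, top_le_iff] at h1
  exact hfin 0 (zero_mem_bset I hlam) h1

theorem mem_subdiff_lagr_iff (A : Matrix (Fin p) (Fin n) ℝ) (I : Finset (Fin p × Fin p))
    {lam : ℝ} (hlam : 0 < lam) (w v : DualSp n I) (x : Vec I) :
    v ∈ subdiff (fun w => lagr A I lam w x) w ↔
      v.fst = w.fst - opSadj A I x ∧ SignCompl I lam (v.snd + x) w.snd := by
  constructor
  · intro h
    have hw : w.snd ∈ bset I lam := snd_mem_bset_of_subdiff hlam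
      (fun w hw => lagr_of_notMem A hw x)
      (fun w hw => by rw [lagr_of_mem A hw]; exact EReal.coe_ne_top _) h
    refine optimality_of_slack A I hlam hw (c := 0) fun w' hw' => ?_
    have h1 := h w'
    simp only [lagr_of_mem A hw, lagr_of_mem A hw'] at h1
    norm_cast at h1
    simpa using h1
  · rintro ⟨h1, h2⟩ w'
    have hw := h2.mem_bset hlam
    by_cases hw' : w'.snd ∈ bset I lam
    · simp only [lagr_of_mem A hw, lagr_of_mem A hw']
      norm_cast
      rw [lagrReal_expand A I w w' x, ← h1, WithLp.prod_inner_apply]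
      have h3 := h2.inner_sub_nonpos hlam hw'
      rw [inner_add_left] at h3
      have h4 : 0 ≤ ‖w'.fst - w.fst‖ ^ 2 := by positivity
      simp only [WithLp.ofLp_fst, WithLp.ofLp_snd, WithLp.sub_fst, WithLp.sub_snd]
      linarith
    · simp only [lagr_of_notMem A hw', le_top]

/-- The subdifferential of the augmented Lagrangian is that of the Lagrangian at the updated
multiplier. -/
theorem subdiff_augLagr_subset (A : Matrix (Fin p) (Fin n) ℝ) (I : Finset (Fin p × Fin p))
    {lam : ℝ} (hlam : 0 < lam) {sig : ℝ} (hsig : 0 < sig) (w : DualSp n I) (x : Vec I) :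
    subdiff (augLagr A I lam sig x) w ⊆
      subdiff (fun w' => lagr A I lam w' (x - sig • resid A I w)) w := by
  intro v h
  have hw : w.snd ∈ bset I lam := snd_mem_bset_of_subdiff hlam
    (fun w hw => augLagr_of_notMem A sig hw x)
    (fun w hw => by rw [augLagr_of_mem A sig hw]; exact EReal.coe_ne_top _) h
  obtain ⟨K, hK, hKb⟩ := exists_norm_le_of_linearMap (opS A I)
  rw [mem_subdiff_lagr_iff A I hlam]
  refine optimality_of_slack A I hlam hw (c := sig / 2 * (K + 1) ^ 2) fun w' hw' => ?_
  have h1 := h w'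
  rw [augLagr_of_mem A sig hw, augLagr_of_mem A sig hw'] at h1
  norm_cast at h1
  have h2 : ‖resid A I w' - resid A I w‖ ≤ (K + 1) * ‖w' - w‖ := by
    rw [resid_sub]
    have h3 : ‖w'.fst - w.fst‖ ≤ ‖w' - w‖ := WithLp.norm_fst_le _ (w' - w)
    have h4 : ‖w'.snd - w.snd‖ ≤ ‖w' - w‖ := WithLp.norm_snd_le _ (w' - w)
    refine (norm_add_le _ _).trans ?_
    have := (hKb (w'.fst - w.fst)).trans (mul_le_mul_of_nonneg_left h3 hK)
    linarith
  have h3 : ‖resid A I w' - resid A I w‖ ^ 2 ≤ (K + 1) ^ 2 * ‖w' - w‖ ^ 2 := by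
    rw [← mul_pow]
    exact pow_le_pow_left₀ (norm_nonneg _) h2 2
  have h4 := mul_le_mul_of_nonneg_left h3 (by positivity : 0 ≤ sig / 2)
  rw [norm_sub_sq_real] at h4
  simp only [lagrReal] at h1 ⊢
  rw [inner_sub_right (resid A I w), inner_sub_right (resid A I w'), inner_smul_right,
    inner_smul_right, real_inner_self_eq_norm_sq]
  linarith

theorem subdiff_neg_lagr (A : Matrix (Fin p) (Fin n) ℝ) {I : Finset (Fin p × Fin p)}
    {lam : ℝ} {w : DualSp n I} (hw : w.snd ∈ bset I lam) (x : Vec I) :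
    subdiff (fun x => -lagr A I lam w x) x = {resid A I w} := by
  ext v
  simp only [subdiff, lagr_of_mem A hw, Set.mem_ofPred_eq, Set.mem_singleton_iff]
  norm_cast
  simp only [lagrReal]
  constructor
  · intro h
    have h1 := h (x + (v - resid A I w))
    rw [add_sub_cancel_left, inner_add_right] at h1
    have h2 : inner ℝ (v - resid A I w) (v - resid A I w) ≤ 0 := by
      rw [inner_sub_left]
      linarith
    exact sub_eq_zero.1 (real_inner_self_nonpos.1 h2)
  · rintro rfl y
    rw [inner_sub_right]
    linarith

theorem mem_TLag_iff (A : Matrix (Fin p) (Fin n) ℝ) (I : Finset (Fin p × Fin p))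
    {lam : ℝ} (hlam : 0 < lam) (u u' : KKTSp n I) :
    u' ∈ TLag A I lam u ↔ (u'.fst.fst = u.fst.fst - opSadj A I u.snd ∧
      SignCompl I lam (u'.fst.snd + u.snd) u.fst.snd) ∧ u'.snd = resid A I u.fst := by
  rw [← mem_subdiff_lagr_iff A I hlam u.fst u'.fst u.snd]
  refine and_congr_right fun h => ?_
  rw [subdiff_neg_lagr A (((mem_subdiff_lagr_iff A I hlam _ _ _).1 h).2.mem_bset hlam)]
  rfl

/-! ### The dual solution -/

/-- The dual point that goes with a primal solution `x`. -/
def dualOf (A : Matrix (Fin p) (Fin n) ℝ) (I : Finset (Fin p × Fin p)) (x : Vec I) : DualSp n I :=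
  WithLp.toLp 2 (opSadj A I x, slack A I x 0)

theorem resid_toLp (A : Matrix (Fin p) (Fin n) ℝ) (I : Finset (Fin p × Fin p)) (x v : Vec I) :
    resid A I (WithLp.toLp 2 (opSadj A I x, slack A I x v)) = v := by
  simp only [resid, slack, WithLp.toLp_fst, WithLp.toLp_snd]
  abel

theorem eq_dualOf_of_resid_eq_zero {A : Matrix (Fin p) (Fin n) ℝ} {I : Finset (Fin p × Fin p)}
    {x : Vec I} {w : DualSp n I} (h : resid A I w = 0) (hw : w.fst = opSadj A I x) :
    w = dualOf A I x := by
  have h1 : w.snd = slack A I x 0 := by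
    rw [slack, ← hw]
    rw [resid] at h
    rw [zero_add, eq_sub_iff_add_eq', ← sub_eq_zero, h]
  rw [dualOf, ← hw, ← h1]
  rfl

theorem dualObj_growth (A : Matrix (Fin p) (Fin n) ℝ) (I : Finset (Fin p × Fin p))
    {lam : ℝ} (hlam : 0 < lam) {x : Vec I} (hx : x ∈ primalSolutions A I lam) {w : DualSp n I}
    (hw : w.snd ∈ bset I lam) (hR : resid A I w = 0) :
    1 / 2 * ‖opSadj A I x‖ ^ 2 + 1 / 2 * ‖w.fst - opSadj A I x‖ ^ 2 ≤ 1 / 2 * ‖w.fst‖ ^ 2 := by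
  have hc := (mem_primalSolutions_iff A I hlam x).1 hx
  have h1 := lagrReal_expand A I (dualOf A I x) w x
  have h2 := hc.inner_sub_nonpos hlam hw
  have h3 : resid A I (dualOf A I x) = 0 := resid_toLp A I x 0
  simp only [lagrReal, hR, h3, inner_zero_left, sub_zero] at h1
  simp only [dualOf, WithLp.toLp_fst, WithLp.toLp_snd, sub_self, inner_zero_left] at h1
  linarith

theorem dualSolutions_eq (A : Matrix (Fin p) (Fin n) ℝ) (I : Finset (Fin p × Fin p))
    {lam : ℝ} (hlam : 0 < lam) {x : Vec I} (hx : x ∈ primalSolutions A I lam) :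
    dualSolutions A I lam = {dualOf A I x} := by
  have hb : (dualOf A I x).snd ∈ bset I lam :=
    ((mem_primalSolutions_iff A I hlam x).1 hx).mem_bset hlam
  have hr : resid A I (dualOf A I x) = 0 := resid_toLp A I x 0
  ext w
  rw [Set.mem_singleton_iff]
  constructor
  · rintro ⟨h1, h2, h3⟩
    have hw : w.snd ∈ bset I lam := by
      by_contra hw
      rw [dualObj_of_notMem hw] at h2
      exact lt_irrefl _ h2
    have h4 := h3 _ hr
    rw [dualObj_of_mem hw, dualObj_of_mem hb, EReal.coe_le_coe_iff] at h4
    have h5 := dualObj_growth A I hlam hx hw h1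
    have h6 : ‖w.fst - opSadj A I x‖ ^ 2 ≤ 0 := by
      change _ ≤ 1 / 2 * ‖opSadj A I x‖ ^ 2 at h4
      linarith
    refine eq_dualOf_of_resid_eq_zero h1 ?_
    have h7 := pow_eq_zero_iff (two_ne_zero) |>.1 (le_antisymm h6 (by positivity))
    exact sub_eq_zero.1 (norm_eq_zero.1 h7)
  · rintro rfl
    refine ⟨hr, ?_, fun w' hw' => ?_⟩
    · rw [dualObj_of_mem hb]
      exact EReal.coe_lt_top _
    · by_cases hwb : w'.snd ∈ bset I lam
      · rw [dualObj_of_mem hb, dualObj_of_mem hwb, EReal.coe_le_coe_iff]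
        have h5 := dualObj_growth A I hlam hx hwb hw'
        have h6 : 0 ≤ ‖w'.fst - opSadj A I x‖ ^ 2 := by positivity
        change 1 / 2 * ‖opSadj A I x‖ ^ 2 ≤ _
        linarith
      · rw [dualObj_of_notMem hwb]
        exact le_top

theorem mem_zeros_TLag_iff (A : Matrix (Fin p) (Fin n) ℝ) (I : Finset (Fin p × Fin p))
    {lam : ℝ} (hlam : 0 < lam) (u : KKTSp n I) :
    u ∈ zeros (TLag A I lam) ↔
      u.snd ∈ primalSolutions A I lam ∧ u.fst = dualOf A I u.snd := by
  rw [zeros, Set.mem_ofPred_eq, mem_TLag_iff A I hlam, mem_primalSolutions_iff A I hlam]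
  simp only [WithLp.zero_fst, WithLp.zero_snd, zero_add]
  constructor
  · rintro ⟨⟨h1, h2⟩, h3⟩
    have h4 := eq_dualOf_of_resid_eq_zero h3.symm (sub_eq_zero.1 h1.symm)
    rw [h4] at h2
    exact ⟨h2, h4⟩
  · rintro ⟨h1, h2⟩
    rw [h2]
    exact ⟨⟨(sub_self _).symm, h1⟩, (resid_toLp A I _ 0).symm⟩

theorem dualOf_eq_of_mem (A : Matrix (Fin p) (Fin n) ℝ) (I : Finset (Fin p × Fin p))
    {lam : ℝ} (hlam : 0 < lam) {x y : Vec I} (hx : x ∈ primalSolutions A I lam)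
    (hy : y ∈ primalSolutions A I lam) : dualOf A I x = dualOf A I y := by
  rw [← Set.singleton_eq_singleton_iff, ← dualSolutions_eq A I hlam hx,
    dualSolutions_eq A I hlam hy]

/-! ### Error bounds -/

/-- Index set of the linear inequalities that describe the optimality system under a fixed sign
pattern. -/
abbrev SysIdx (n : ℕ) (I : Finset (Fin p × Fin p)) : Type :=
  (Fin 8 × Idx I) ⊕ (Fin 2 × (Fin p × Fin n))

/-- The coordinate `x_i` of a triple `(Y, z, x)`. -/
def xCoord (n : ℕ) (I : Finset (Fin p × Fin p)) (i : Idx I) : KKTSp n I →ₗ[ℝ] ℝ where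
  toFun u := u.snd i
  map_add' := by simp
  map_smul' := by simp

theorem xCoord_apply (I : Finset (Fin p × Fin p)) (i : Idx I) (u : KKTSp n I) :
    xCoord n I i u = u.snd i :=
  rfl

/-- The coordinate `z_i` of a triple `(Y, z, x)`. -/
def zCoord (n : ℕ) (I : Finset (Fin p × Fin p)) (i : Idx I) : KKTSp n I →ₗ[ℝ] ℝ where
  toFun u := u.fst.snd i
  map_add' := by simp
  map_smul' := by simp

theorem zCoord_apply (I : Finset (Fin p × Fin p)) (i : Idx I) (u : KKTSp n I) :
    zCoord n I i u = u.fst.snd i :=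
  rfl

/-- Left-hand sides of the optimality system under the sign pattern `s`. -/
def sysFun (A : Matrix (Fin p) (Fin n) ℝ) (I : Finset (Fin p × Fin p)) (s : Idx I → SignType) :
    SysIdx n I → KKTSp n I →ₗ[ℝ] ℝ :=
  let R : Idx I → KKTSp n I →ₗ[ℝ] ℝ := fun i =>
    { toFun := fun u => (opS A I u.fst.fst + u.fst.snd) i
      map_add' := by intro u v; simp; ring
      map_smul' := by intro c u; simp; ring }
  let Y : Fin p × Fin n → KKTSp n I →ₗ[ℝ] ℝ := fun j =>
    { toFun := fun u => (u.fst.fst - opSadj A I u.snd) j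
      map_add' := by intro u v; simp; ring
      map_smul' := by intro c u; simp; ring }
  Sum.elim
    (fun q => ![-(s q.2 : ℝ) • xCoord n I q.2, (1 - (s q.2 : ℝ) ^ 2) • xCoord n I q.2,
      -(1 - (s q.2 : ℝ) ^ 2) • xCoord n I q.2, zCoord n I q.2, -zCoord n I q.2, -(s q.2 : ℝ) • zCoord n I q.2, R q.2, -R q.2] q.1)
    (fun q => ![Y q.2, -Y q.2] q.1)

/-- Right-hand sides of the optimality system under the sign pattern `s`. -/
def sysRhs (n : ℕ) (I : Finset (Fin p × Fin p)) (lam : ℝ) (s : Idx I → SignType) :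
    SysIdx n I → ℝ :=
  Sum.elim
    (fun q => ![0, 0, 0, wt I lam q.2, wt I lam q.2, -(s q.2 : ℝ) ^ 2 * wt I lam q.2, e1 I q.2,
      -e1 I q.2] q.1)
    (fun q => ![0, 0] q.1)

theorem sys_iff (A : Matrix (Fin p) (Fin n) ℝ) (I : Finset (Fin p × Fin p)) (lam : ℝ)
    (s : Idx I → SignType) (u : KKTSp n I) (ε : ℝ) :
    (∀ j, sysFun A I s j u ≤ sysRhs n I lam s j + ε) ↔
      (∀ i, -(s i : ℝ) * u.snd i ≤ ε ∧ (1 - (s i : ℝ) ^ 2) * u.snd i ≤ ε ∧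
        -(1 - (s i : ℝ) ^ 2) * u.snd i ≤ ε ∧ u.fst.snd i ≤ wt I lam i + ε ∧
        -u.fst.snd i ≤ wt I lam i + ε ∧
        -(s i : ℝ) * u.fst.snd i ≤ -(s i : ℝ) ^ 2 * wt I lam i + ε ∧
        |resid A I u.fst i| ≤ ε) ∧
      ∀ j, |(u.fst.fst - opSadj A I u.snd) j| ≤ ε := by
  rw [Sum.forall, Prod.forall, Prod.forall, forall_comm, forall_comm (α := Fin 2)]
  refine and_congr (forall_congr' fun i => ?_) (forall_congr' fun j => ?_)
  · rw [abs_le]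
    simp only [Fin.forall_fin_succ, sysFun, sysRhs, resid, xCoord_apply, zCoord_apply, LinearMap.coe_mk, AddHom.coe_mk,
      Sum.elim_inl, Matrix.cons_val_zero, Matrix.cons_val_succ, LinearMap.smul_apply,
      LinearMap.neg_apply, smul_eq_mul, PiLp.add_apply, PiLp.sub_apply, zero_add,
      IsEmpty.forall_iff, and_true]
    constructor
    · rintro ⟨h1, h2, h3, h4, h5, h6, h7, h8⟩
      refine ⟨?_, ?_, ?_, ?_, ?_, ?_, ?_, ?_⟩ <;> linarith
    · rintro ⟨h1, h2, h3, h4, h5, h6, h7, h8⟩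
      refine ⟨?_, ?_, ?_, ?_, ?_, ?_, ?_, ?_⟩ <;> linarith
  · rw [abs_le]
    simp only [Fin.forall_fin_succ, sysFun, sysRhs, LinearMap.coe_mk, AddHom.coe_mk,
      Sum.elim_inr, Matrix.cons_val_zero, Matrix.cons_val_succ,
      LinearMap.neg_apply, PiLp.sub_apply, zero_add, IsEmpty.forall_iff, and_true]
    constructor
    · rintro ⟨h1, h2⟩
      constructor <;> linarith
    · rintro ⟨h1, h2⟩
      constructor <;> linarith

theorem abs_apply_le_norm {ι : Type*} [Fintype ι] (x : EuclideanSpace ℝ ι) (i : ι) :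
    |x i| ≤ ‖x‖ :=
  PiLp.norm_apply_le x i

theorem TLag_local_error_bound (A : Matrix (Fin p) (Fin n) ℝ) (I : Finset (Fin p × Fin p))
    {lam : ℝ} (hlam : 0 < lam) :
    ∃ c : ℝ, 0 ≤ c ∧ ∃ δ : ℝ, 0 < δ ∧ ∀ u u' : KKTSp n I, u' ∈ TLag A I lam u → ‖u'‖ < δ →
      ∃ u₀ ∈ zeros (TLag A I lam), ‖u₀ - u‖ ≤ c * ‖u'‖ := by
  choose c hc δ hδ h using fun s : Idx I → SignType =>
    exists_solution_near (sysFun A I s) (sysRhs n I lam s)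
  refine ⟨∑ s, c s, Finset.sum_nonneg fun s _ => hc s, Finset.univ.inf' Finset.univ_nonempty δ,
    (Finset.lt_inf'_iff _).2 fun s _ => hδ s, fun u u' hu' hlt => ?_⟩
  rw [mem_TLag_iff A I hlam] at hu'
  obtain ⟨⟨hY, hZ⟩, hR⟩ := hu'
  set ν := u'.fst.snd with hν
  have hn1 : ‖u'.fst‖ ≤ ‖u'‖ := WithLp.norm_fst_le _ u'
  have hn2 : ‖u'.fst.fst‖ ≤ ‖u'‖ := (WithLp.norm_fst_le _ u'.fst).trans hn1
  have hn3 : ‖ν‖ ≤ ‖u'‖ := (WithLp.norm_snd_le _ u'.fst).trans hn1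
  have hn4 : ‖u'.snd‖ ≤ ‖u'‖ := WithLp.norm_snd_le _ u'
  set ε := ‖u'‖ with hε
  have hε0 : 0 ≤ ε := norm_nonneg _
  set s : Idx I → SignType := fun i => SignType.sign ((ν + u.snd) i) with hs
  obtain ⟨u₀, hu₀, hd⟩ := h s u ε hε0 (hlt.trans_le (Finset.inf'_le _ (Finset.mem_univ s))) (by
    rw [sys_iff]
    refine ⟨fun i => ?_, fun j => ?_⟩
    · have hνi := abs_le.1 ((abs_apply_le_norm ν i).trans hn3)
      obtain ⟨hz1, hz2⟩ := hZ i
      have hz3 := abs_le.1 hz1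
      have hRi : |resid A I u.fst i| ≤ ε := by
        rw [← hR]
        exact (abs_apply_le_norm _ i).trans hn4
      simp only [PiLp.add_apply] at hz2
      simp only [hs, PiLp.add_apply]
      rcases lt_trichotomy (ν i + u.snd i) 0 with hx | hx | hx
      · rw [sign_neg hx]
        rw [abs_of_neg hx] at hz2
        have hz4 : u.fst.snd i = -wt I lam i := mul_right_cancel₀ hx.ne (by linarith)
        simp only [SignType.coe_neg_one]
        refine ⟨?_, ?_, ?_, ?_, ?_, ?_, hRi⟩ <;> linarith
      · rw [hx, sign_zero]
        simp only [SignType.coe_zero]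
        refine ⟨?_, ?_, ?_, ?_, ?_, ?_, hRi⟩ <;> linarith
      · rw [sign_pos hx]
        rw [abs_of_pos hx] at hz2
        have hz4 : u.fst.snd i = wt I lam i := mul_right_cancel₀ hx.ne' (by linarith)
        simp only [SignType.coe_one]
        refine ⟨?_, ?_, ?_, ?_, ?_, ?_, hRi⟩ <;> linarith
    · rw [← hY]
      exact (abs_apply_le_norm _ j).trans hn2)
  refine ⟨u₀, ?_, hd.trans ?_⟩
  · have hu₁ : ∀ j, sysFun A I s j u₀ ≤ sysRhs n I lam s j + 0 := by simpa using hu₀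
    rw [sys_iff] at hu₁
    obtain ⟨h1, h2⟩ := hu₁
    rw [zeros, Set.mem_ofPred_eq, mem_TLag_iff A I hlam]
    simp only [WithLp.zero_fst, WithLp.zero_snd, zero_add]
    refine ⟨⟨?_, fun i => ?_⟩, ?_⟩
    · ext j
      exact (abs_nonpos_iff.1 (h2 j)).symm
    · obtain ⟨g1, g2, g3, g4, g5, g6, -⟩ := h1 i
      refine ⟨abs_le.2 ⟨by linarith, by linarith⟩, ?_⟩
      rcases hsi : s i with _ | _ | _ <;> rw [hsi] at g1 g2 g3 g6 <;> simp at g1 g2 g3 g6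
      · rw [le_antisymm g2 g3, abs_zero, mul_zero, mul_zero]
      · rw [abs_of_nonpos g1, le_antisymm g6 (by linarith)]
        ring
      · rw [abs_of_nonneg g1, le_antisymm (by linarith) g6]
    · ext i
      exact (abs_nonpos_iff.1 (h1 i).2.2.2.2.2.2).symm
  · exact mul_le_mul_of_nonneg_right
      (Finset.single_le_sum (fun s _ => hc s) (Finset.mem_univ s)) hε0

theorem norm_le_norm_fst_add_norm_snd {E F : Type*} [NormedAddCommGroup E] [NormedAddCommGroup F]
    (w : WithLp 2 (E × F)) : ‖w‖ ≤ ‖w.fst‖ + ‖w.snd‖ := by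
  refine abs_le_of_sq_le_sq' ?_ (by positivity) |>.2
  rw [WithLp.prod_norm_sq_eq_of_L2]
  nlinarith [mul_nonneg (norm_nonneg w.fst) (norm_nonneg w.snd)]

theorem infDist_primalSolutions_le (A : Matrix (Fin p) (Fin n) ℝ) (I : Finset (Fin p × Fin p))
    {lam : ℝ} (hlam : 0 < lam) (hO : (primalSolutions A I lam).Nonempty) (u : KKTSp n I) :
    Metric.infDist u.snd (primalSolutions A I lam) ≤ Metric.infDist u (zeros (TLag A I lam)) := by
  obtain ⟨x, hx⟩ := hO
  refine (Metric.le_infDist ⟨WithLp.toLp 2 (dualOf A I x, x), ?_⟩).2 fun v hv => ?_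
  · exact (mem_zeros_TLag_iff A I hlam _).2 ⟨hx, rfl⟩
  · refine (Metric.infDist_le_dist_of_mem ((mem_zeros_TLag_iff A I hlam v).1 hv).1).trans ?_
    rw [dist_eq_norm, dist_eq_norm]
    exact WithLp.norm_snd_le _ (u - v)

theorem TLag_error_bound (A : Matrix (Fin p) (Fin n) ℝ) (I : Finset (Fin p × Fin p))
    {lam : ℝ} (hlam : 0 < lam) (hO : (primalSolutions A I lam).Nonempty) {r : ℝ} (hr : 0 < r) :
    ∃ κ : ℝ, 0 ≤ κ ∧ ∀ u u' : KKTSp n I, u' ∈ TLag A I lam u →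
      Metric.infDist u.snd (primalSolutions A I lam) ≤ r →
      Metric.infDist u (zeros (TLag A I lam)) ≤ κ * ‖u'‖ := by
  obtain ⟨c, hc, δ, hδ, h⟩ := TLag_local_error_bound A I hlam
  obtain ⟨K, hK, hKb⟩ := exists_norm_le_of_linearMap (opSadj A I)
  obtain ⟨K', hK', hKb'⟩ := exists_norm_le_of_linearMap (opS A I)
  set B : ℝ := K * r + K' * (K * r) + r with hB
  have hB0 : 0 ≤ B := by positivity
  refine ⟨c + ((2 + K') + B / δ), by positivity, fun u u' hu' hdist => ?_⟩
  have hn0 : 0 ≤ ‖u'‖ := norm_nonneg _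
  by_cases hlt : ‖u'‖ < δ
  · obtain ⟨u₀, hu₀, hd⟩ := h u u' hu' hlt
    refine (Metric.infDist_le_dist_of_mem hu₀).trans ?_
    rw [dist_comm, dist_eq_norm]
    refine hd.trans (mul_le_mul_of_nonneg_right ?_ hn0)
    have : 0 ≤ (2 + K') + B / δ := by positivity
    linarith
  · rw [not_lt] at hlt
    obtain ⟨x, hx, hxd⟩ := (isClosed_primalSolutions A I lam).exists_infDist_eq_dist hO u.snd
    rw [hxd, dist_eq_norm] at hdist
    rw [mem_TLag_iff A I hlam] at hu'
    obtain ⟨⟨hY, -⟩, hR⟩ := hu'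
    have hn1 : ‖u'.fst.fst‖ ≤ ‖u'‖ :=
      (WithLp.norm_fst_le _ u'.fst).trans (WithLp.norm_fst_le _ u')
    have hn4 : ‖u'.snd‖ ≤ ‖u'‖ := WithLp.norm_snd_le _ u'
    set u₀ : KKTSp n I := WithLp.toLp 2 (dualOf A I x, x) with hu₀
    have hmem : u₀ ∈ zeros (TLag A I lam) := (mem_zeros_TLag_iff A I hlam _).2 ⟨hx, rfl⟩
    have h1 : ‖(u - u₀).fst.fst‖ ≤ ‖u'‖ + K * r := by
      have e : (u - u₀).fst.fst = u'.fst.fst + opSadj A I (u.snd - x) := by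
        rw [hY, map_sub, sub_add_sub_cancel]
        rfl
      rw [e]
      refine (norm_add_le _ _).trans (add_le_add hn1 ((hKb _).trans ?_))
      exact mul_le_mul_of_nonneg_left hdist hK
    have h2 : ‖(u - u₀).fst.snd‖ ≤ ‖u'‖ + K' * (‖u'‖ + K * r) := by
      have e : (u - u₀).fst.snd = u'.snd - opS A I (u - u₀).fst.fst := by
        rw [eq_sub_iff_add_eq', hR, ← sub_zero (resid A I u.fst), ← resid_toLp A I x 0,
          resid_sub]
        rfl
      rw [e]
      refine (norm_sub_le _ _).trans (add_le_add hn4 ((hKb' _).trans ?_))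
      exact mul_le_mul_of_nonneg_left h1 hK'
    have h3 : ‖u - u₀‖ ≤ ‖(u - u₀).fst.fst‖ + ‖(u - u₀).fst.snd‖ + ‖u.snd - x‖ :=
      (norm_le_norm_fst_add_norm_snd (u - u₀)).trans
        (add_le_add (norm_le_norm_fst_add_norm_snd (u - u₀).fst) le_rfl)
    refine (Metric.infDist_le_dist_of_mem hmem).trans ?_
    rw [dist_eq_norm]
    have h4 : B ≤ B / δ * ‖u'‖ := by
      rw [div_mul_eq_mul_div, le_div_iff₀ hδ]
      exact mul_le_mul_of_nonneg_left hlt hB0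
    have h5 : 0 ≤ c * ‖u'‖ := by positivity
    have h6 : (c + ((2 + K') + B / δ)) * ‖u'‖ =
      c * ‖u'‖ + 2 * ‖u'‖ + K' * ‖u'‖ + B / δ * ‖u'‖ := by ring
    have h7 : K' * (‖u'‖ + K * r) = K' * ‖u'‖ + K' * (K * r) := by ring
    linarith

theorem le_mul_infDist_zero {E : Type*} [NormedAddCommGroup E] {s : Set E} (hs : s.Nonempty)
    {a κ : ℝ} (hκ : 0 ≤ κ) (h : ∀ v ∈ s, a ≤ κ * ‖v‖) : a ≤ κ * Metric.infDist 0 s := by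
  rcases hκ.eq_or_lt with rfl | hκ
  · obtain ⟨v, hv⟩ := hs
    simpa using h v hv
  · rw [← div_le_iff₀' hκ]
    refine (Metric.le_infDist hs).2 fun v hv => ?_
    rw [div_le_iff₀' hκ, dist_zero_left]
    exact h v hv

theorem hasErrorBound_TLag {A : Matrix (Fin p) (Fin n) ℝ} {I : Finset (Fin p × Fin p)}
    {lam : ℝ} (hlam : 0 < lam) (hO : (primalSolutions A I lam).Nonempty) {r κ : ℝ} (hκ : 0 ≤ κ)
    (h : ∀ u u' : KKTSp n I, u' ∈ TLag A I lam u →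
      Metric.infDist u.snd (primalSolutions A I lam) ≤ r →
      Metric.infDist u (zeros (TLag A I lam)) ≤ κ * ‖u'‖) :
    HasErrorBound (TLag A I lam) r κ := fun u hne hu =>
  le_mul_infDist_zero hne hκ fun v hv =>
    h u v hv ((infDist_primalSolutions_le A I hlam hO u).trans hu)

theorem hasErrorBound_TGam {A : Matrix (Fin p) (Fin n) ℝ} {I : Finset (Fin p × Fin p)}
    {lam : ℝ} (hlam : 0 < lam) (hO : (primalSolutions A I lam).Nonempty) {r κ : ℝ} (hκ : 0 ≤ κ)
    (h : ∀ u u' : KKTSp n I, u' ∈ TLag A I lam u →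
      Metric.infDist u.snd (primalSolutions A I lam) ≤ r →
      Metric.infDist u (zeros (TLag A I lam)) ≤ κ * ‖u'‖) :
    HasErrorBound (TGam A I lam) r κ := by
  intro x hne hx
  rw [zeros_TGam] at *
  refine le_mul_infDist_zero hne hκ fun v hv => ?_
  rw [mem_TGam_iff A I hlam] at hv
  set u : KKTSp n I := WithLp.toLp 2 (WithLp.toLp 2 (opSadj A I x, slack A I x v), x) with hu
  set u' : KKTSp n I := WithLp.toLp 2 (0, v) with hu'
  have hmem : u' ∈ TLag A I lam u := by
    rw [mem_TLag_iff A I hlam]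
    refine ⟨⟨(sub_self _).symm, ?_⟩, (resid_toLp A I x v).symm⟩
    simpa [hu, hu'] using hv
  have hn : ‖u'‖ ≤ ‖v‖ := by
    refine (norm_le_norm_fst_add_norm_snd u').trans ?_
    simp [hu']
  refine (infDist_primalSolutions_le A I hlam hO u).trans ((h u u' hmem hx).trans ?_)
  exact mul_le_mul_of_nonneg_left hn hκ

/-! ### The proximal point -/

theorem exists_prox (A : Matrix (Fin p) (Fin n) ℝ) (I : Finset (Fin p × Fin p)) {lam : ℝ}
    (hlam : 0 < lam) (hO : (primalSolutions A I lam).Nonempty) {sig : ℝ} (hsig : 0 < sig) (x : Vec I) :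
    ∃ q, SignCompl I lam q (slack A I q (sig⁻¹ • (x - q))) := by
  obtain ⟨x₀, hx₀⟩ := hO
  rw [mem_primalSolutions_iff_le] at hx₀
  have hcont : Continuous fun u => Gam A I lam u + sig⁻¹ / 2 * dist u x ^ 2 := by
    have := continuous_Gam A I lam
    fun_prop
  have hlim : Tendsto (fun u => Gam A I lam u + sig⁻¹ / 2 * dist u x ^ 2)
      (cocompact (Vec I)) atTop := by
    refine tendsto_atTop_mono (fun u => add_le_add_left (hx₀ u) _) ?_
    refine tendsto_atTop_add_const_left _ _ (Tendsto.const_mul_atTop (by positivity) ?_)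
    exact (tendsto_pow_atTop two_ne_zero).comp (tendsto_dist_right_cocompact_atTop x)
  obtain ⟨q, hq⟩ := hcont.exists_forall_le hlim
  refine ⟨q, signCompl_of_Gam_slack A I hlam (c := sig⁻¹ / 2) fun u => ?_⟩
  have h1 := hq u
  rw [dist_eq_norm, dist_eq_norm] at h1
  have h2 : ‖u - x‖ ^ 2 = ‖u - q‖ ^ 2 - 2 * inner ℝ (x - q) (u - q) + ‖q - x‖ ^ 2 := by
    have : u - x = (u - q) - (x - q) := by abel
    rw [this, norm_sub_sq_real, real_inner_comm, norm_sub_rev x q]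
  rw [h2] at h1
  rw [real_inner_smul_left]
  linarith

/-- An approximate minimiser of the augmented Lagrangian yields an approximate proximal point. -/
theorem gap_estimate {A : Matrix (Fin p) (Fin n) ℝ} {I : Finset (Fin p × Fin p)} {lam : ℝ}
    (hlam : 0 < lam) {sig : ℝ} (hsig : 0 < sig) {x q : Vec I}
    (hq : SignCompl I lam q (slack A I q (sig⁻¹ • (x - q)))) {w : DualSp n I} {δ : ℝ}
    (h : augLagr A I lam sig x w - ⨅ w', augLagr A I lam sig x w' ≤ (δ : EReal)) :
    1 / 2 * ‖w.fst - opSadj A I q‖ ^ 2 + (2 * sig)⁻¹ * ‖x - sig • resid A I w - q‖ ^ 2 ≤ δ := by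
  set v := sig⁻¹ • (x - q) with hv
  set w₀ : DualSp n I := WithLp.toLp 2 (opSadj A I q, slack A I q v) with hw₀
  have hR₀ : resid A I w₀ = v := resid_toLp A I q v
  have hx : x = q + sig • v := by
    rw [hv, smul_inv_smul₀ hsig.ne', add_sub_cancel]
  have hb₀ : w₀.snd ∈ bset I lam := hq.mem_bset hlam
  have h1 := (EReal.sub_le_sub (le_refl (augLagr A I lam sig x w))
    (iInf_le (augLagr A I lam sig x) w₀)).trans h
  rw [augLagr_of_mem A sig hb₀] at h1
  by_cases hb : w.snd ∈ bset I lam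
  swap
  · rw [augLagr_of_notMem A sig hb, EReal.top_sub_coe, top_le_iff] at h1
    exact absurd h1 (EReal.coe_ne_top _)
  rw [augLagr_of_mem A sig hb, ← EReal.coe_sub, EReal.coe_le_coe_iff, hR₀] at h1
  have h2 := lagrReal_expand A I w₀ w q
  have h3 := hq.inner_sub_nonpos hlam hb
  have h4 : inner ℝ (w₀.fst - opSadj A I q) (w.fst - w₀.fst) = 0 := by
    rw [hw₀, WithLp.toLp_fst, sub_self, inner_zero_left]
  have h5 : ∀ w : DualSp n I, lagrReal A I w x = lagrReal A I w q -
      sig * inner ℝ (resid A I w) v := by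
    intro w
    rw [lagrReal, lagrReal, hx, inner_add_right, inner_smul_right]
    ring
  rw [h5 w, h5 w₀, hR₀, real_inner_self_eq_norm_sq] at h1
  have h6 : x - sig • resid A I w - q = sig • (v - resid A I w) := by
    rw [hx, smul_sub]
    abel
  have h7 : (2 * sig)⁻¹ * ‖x - sig • resid A I w - q‖ ^ 2 =
      sig / 2 * (‖v‖ ^ 2 - 2 * inner ℝ (resid A I w) v + ‖resid A I w‖ ^ 2) := by
    rw [h6, norm_smul, mul_pow, Real.norm_eq_abs, sq_abs, norm_sub_sq_real,
      real_inner_comm (resid A I w) v]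
    field_simp
  rw [h7]
  change 1 / 2 * ‖w.fst - w₀.fst‖ ^ 2 + _ ≤ _
  change inner ℝ q (w.snd - w₀.snd) ≤ 0 at h3
  linarith

theorem prox_fejer {A : Matrix (Fin p) (Fin n) ℝ} {I : Finset (Fin p × Fin p)} {lam sig : ℝ}
    (hsig : 0 < sig) {x q : Vec I} (hq : SignCompl I lam q (slack A I q (sig⁻¹ • (x - q))))
    {y : Vec I} (hy : y ∈ primalSolutions A I lam) :
    ‖q - y‖ ^ 2 + ‖q - x‖ ^ 2 ≤ ‖x - y‖ ^ 2 := by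
  rw [mem_primalSolutions_iff_le] at hy
  have h1 := hq.Gam_subgradient y
  have h2 := hy q
  rw [real_inner_smul_left] at h1
  have h3 : inner ℝ (x - q) (y - q) ≤ 0 := by
    have h4 : sig⁻¹ * inner ℝ (x - q) (y - q) ≤ 0 := by linarith
    exact nonpos_of_mul_nonpos_right h4 (inv_pos.2 hsig)
  have h5 : ‖x - y‖ ^ 2 = ‖x - q‖ ^ 2 - 2 * inner ℝ (x - q) (y - q) + ‖y - q‖ ^ 2 := by
    rw [← norm_sub_sq_real, sub_sub_sub_cancel_right]
  rw [norm_sub_rev q y, norm_sub_rev q x]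
  linarith

/-! ### Inexact Fejér monotone sequences -/

theorem exists_tendsto_of_le_add_summable {a ε : ℕ → ℝ} (ha : ∀ k, 0 ≤ a k)
    (hε : ∀ k, 0 ≤ ε k) (hs : Summable ε) (h : ∀ k, a (k + 1) ≤ a k + ε k) :
    ∃ l, Tendsto a atTop (𝓝 l) := by
  have hanti : Antitone fun k => a k - ∑ j ∈ Finset.range k, ε j := by
    refine antitone_nat_of_succ_le fun k => ?_
    rw [Finset.sum_range_succ]
    linarith [h k]
  have hbdd : BddBelow (Set.range fun k => a k - ∑ j ∈ Finset.range k, ε j) := by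
    refine ⟨-∑' j, ε j, ?_⟩
    rintro _ ⟨k, rfl⟩
    have := hs.sum_le_tsum (Finset.range k) fun j _ => hε j
    linarith [ha k]
  have h1 := (tendsto_atTop_ciInf hanti hbdd).add hs.hasSum.tendsto_sum_nat
  simp only [sub_add_cancel] at h1
  exact ⟨_, h1⟩

section Fejer

variable {V : Type*} [NormedAddCommGroup V] {O : Set V} {x q : ℕ → V}
  {ε : ℕ → ℝ}

theorem fejer_norm_le {a b c : V} (h : ‖b - c‖ ^ 2 + ‖b - a‖ ^ 2 ≤ ‖a - c‖ ^ 2) :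
    ‖b - c‖ ≤ ‖a - c‖ := by
  refine (abs_le_of_sq_le_sq' ?_ (norm_nonneg _)).2
  have : 0 ≤ ‖b - a‖ ^ 2 := by positivity
  linarith

theorem exists_tendsto_norm_of_fejer (hε : ∀ k, 0 ≤ ε k) (hs : Summable ε)
    (hq : ∀ k, ∀ y ∈ O, ‖q k - y‖ ^ 2 + ‖q k - x k‖ ^ 2 ≤ ‖x k - y‖ ^ 2)
    (hx : ∀ k, ‖x (k + 1) - q k‖ ≤ ε k) {y : V} (hy : y ∈ O) :
    ∃ l, Tendsto (fun k => ‖x k - y‖) atTop (𝓝 l) := by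
  refine exists_tendsto_of_le_add_summable (fun _ => norm_nonneg _) hε hs fun k => ?_
  have h1 := fejer_norm_le (hq k y hy)
  have h2 := norm_sub_le_norm_sub_add_norm_sub (x (k + 1)) (q k) y
  linarith [hx k]

theorem tendsto_sub_zero_of_fejer (hO : O.Nonempty) (hε : ∀ k, 0 ≤ ε k) (hs : Summable ε)
    (hq : ∀ k, ∀ y ∈ O, ‖q k - y‖ ^ 2 + ‖q k - x k‖ ^ 2 ≤ ‖x k - y‖ ^ 2)
    (hx : ∀ k, ‖x (k + 1) - q k‖ ≤ ε k) :
    Tendsto (fun k => q k - x k) atTop (𝓝 0) := by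
  obtain ⟨y, hy⟩ := hO
  obtain ⟨l, hl⟩ := exists_tendsto_norm_of_fejer hε hs hq hx hy
  have hl1 := (hl.comp (tendsto_add_atTop_nat 1)).sub hs.tendsto_atTop_zero
  rw [sub_zero] at hl1
  have hql : Tendsto (fun k => ‖q k - y‖) atTop (𝓝 l) := by
    refine tendsto_of_tendsto_of_tendsto_of_le_of_le hl1 hl (fun k => ?_)
      fun k => fejer_norm_le (hq k y hy)
    have h2 := norm_sub_le_norm_sub_add_norm_sub (x (k + 1)) (q k) y
    simp only [Function.comp_apply]
    linarith [hx k]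
  have h0 := (hl.pow 2).sub (hql.pow 2)
  rw [sub_self] at h0
  have hsq : Tendsto (fun k => ‖q k - x k‖ ^ 2) atTop (𝓝 0) :=
    squeeze_zero (fun k => by positivity) (fun k => by linarith [hq k y hy]) h0
  have hsqrt := hsq.sqrt
  simp only [Real.sqrt_sq (norm_nonneg _), Real.sqrt_zero] at hsqrt
  exact tendsto_zero_iff_norm_tendsto_zero.2 hsqrt

theorem exists_limit_of_fejer [ProperSpace V] (hO : O.Nonempty) (hε : ∀ k, 0 ≤ ε k)
    (hs : Summable ε)
    (hq : ∀ k, ∀ y ∈ O, ‖q k - y‖ ^ 2 + ‖q k - x k‖ ^ 2 ≤ ‖x k - y‖ ^ 2)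
    (hx : ∀ k, ‖x (k + 1) - q k‖ ≤ ε k)
    (hcl : ∀ (φ : ℕ → ℕ) (y : V), StrictMono φ → Tendsto (x ∘ φ) atTop (𝓝 y) → y ∈ O) :
    ∃ y ∈ O, Tendsto x atTop (𝓝 y) := by
  obtain ⟨y₀, hy₀⟩ := hO
  obtain ⟨l, hl⟩ := exists_tendsto_norm_of_fejer hε hs hq hx hy₀
  obtain ⟨B, hB⟩ := hl.bddAbove_range
  have hmem : ∀ k, x k ∈ Metric.closedBall y₀ B := fun k => by
    rw [mem_closedBall_iff_norm]
    exact hB ⟨k, rfl⟩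
  obtain ⟨y, -, φ, hφ, hy⟩ := (isCompact_closedBall y₀ B).tendsto_subseq hmem
  have hyO := hcl φ y hφ hy
  refine ⟨y, hyO, ?_⟩
  obtain ⟨m, hm⟩ := exists_tendsto_norm_of_fejer hε hs hq hx hyO
  have h1 := hm.comp hφ.tendsto_atTop
  have h2 : Tendsto (fun k => ‖(x ∘ φ) k - y‖) atTop (𝓝 0) :=
    tendsto_iff_norm_sub_tendsto_zero.1 hy
  rw [tendsto_nhds_unique h1 h2] at hm
  exact tendsto_iff_norm_sub_tendsto_zero.2 hm

theorem infDist_sq_add_le_of_fejer [ProperSpace V] (hO : O.Nonempty) (hc : IsClosed O) {a b : V}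
    (h : ∀ y ∈ O, ‖b - y‖ ^ 2 + ‖b - a‖ ^ 2 ≤ ‖a - y‖ ^ 2) :
    Metric.infDist b O ^ 2 + ‖b - a‖ ^ 2 ≤ Metric.infDist a O ^ 2 := by
  obtain ⟨y, hy, hd⟩ := hc.exists_infDist_eq_dist hO a
  rw [hd, dist_eq_norm]
  refine le_trans ?_ (h y hy)
  have : Metric.infDist b O ≤ ‖b - y‖ := by
    rw [← dist_eq_norm]
    exact Metric.infDist_le_dist_of_mem hy
  have := pow_le_pow_left₀ Metric.infDist_nonneg this 2
  linarith

theorem infDist_le_add_sum_of_fejer [ProperSpace V] (hO : O.Nonempty) (hc : IsClosed O)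
    (hq : ∀ k, ∀ y ∈ O, ‖q k - y‖ ^ 2 + ‖q k - x k‖ ^ 2 ≤ ‖x k - y‖ ^ 2)
    (hx : ∀ k, ‖x (k + 1) - q k‖ ≤ ε k) (k : ℕ) :
    Metric.infDist (x k) O ≤ Metric.infDist (x 0) O + ∑ j ∈ Finset.range k, ε j := by
  induction k with
  | zero => simp
  | succ k ih =>
    rw [Finset.sum_range_succ]
    have h1 := infDist_sq_add_le_of_fejer hO hc (hq k)
    have h2 : Metric.infDist (q k) O ≤ Metric.infDist (x k) O := by
      refine (abs_le_of_sq_le_sq' ?_ Metric.infDist_nonneg).2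
      have : 0 ≤ ‖q k - x k‖ ^ 2 := by positivity
      linarith
    have h3 : Metric.infDist (x (k + 1)) O ≤ Metric.infDist (q k) O + dist (x (k + 1)) (q k) :=
      Metric.infDist_le_infDist_add_dist
    rw [dist_eq_norm] at h3
    linarith [hx k]

/-- One step of an inexact proximal iteration contracts the distance to the target set. -/
theorem infDist_step_le [ProperSpace V] (hO : O.Nonempty) (hc : IsClosed O) {a b a' : V}
    (h : ∀ y ∈ O, ‖b - y‖ ^ 2 + ‖b - a‖ ^ 2 ≤ ‖a - y‖ ^ 2) {κ sig θ : ℝ} (hκ : 0 ≤ κ)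
    (hsig : 0 < sig) (hθ : 0 ≤ θ) (hθ1 : θ < 1)
    (hκb : Metric.infDist b O ≤ κ * (sig⁻¹ * ‖b - a‖)) (ha' : ‖a' - b‖ ≤ θ * ‖a' - a‖) :
    Metric.infDist a' O ≤ zeta κ sig θ * Metric.infDist a O := by
  set d := Metric.infDist a O with hd
  set e := Metric.infDist b O with he
  have hd0 : 0 ≤ d := Metric.infDist_nonneg
  have he0 : 0 ≤ e := Metric.infDist_nonneg
  have h1 : e ^ 2 + ‖b - a‖ ^ 2 ≤ d ^ 2 := infDist_sq_add_le_of_fejer hO hc h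
  have hn : ‖b - a‖ ≤ d := by
    refine (abs_le_of_sq_le_sq' ?_ hd0).2
    nlinarith [sq_nonneg e]
  have hpos : 0 < κ ^ 2 + sig ^ 2 := by positivity
  have hsqrt : 0 < √(κ ^ 2 + sig ^ 2) := Real.sqrt_pos.2 hpos
  have h2 : sig * e ≤ κ * ‖b - a‖ := by
    have := mul_le_mul_of_nonneg_left hκb hsig.le
    have h3 : sig * (κ * (sig⁻¹ * ‖b - a‖)) = κ * ‖b - a‖ := by field_simp
    linarith
  have h3 : e ≤ κ * (√(κ ^ 2 + sig ^ 2))⁻¹ * d := by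
    rw [mul_right_comm, ← div_eq_mul_inv, le_div_iff₀ hsqrt]
    refine (abs_le_of_sq_le_sq' ?_ (mul_nonneg hκ hd0)).2
    rw [mul_pow, Real.sq_sqrt hpos.le, mul_pow]
    have h4 := pow_le_pow_left₀ (mul_nonneg hsig.le he0) h2 2
    have h5 := mul_le_mul_of_nonneg_left h1 (sq_nonneg κ)
    rw [mul_pow, mul_pow] at h4
    linarith
  obtain ⟨y, hy, hyd⟩ := hc.exists_infDist_eq_dist hO b
  rw [dist_eq_norm] at hyd
  have h4 : Metric.infDist a' O ≤ ‖a' - y‖ := by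
    rw [← dist_eq_norm]
    exact Metric.infDist_le_dist_of_mem hy
  have h5 := norm_sub_le_norm_sub_add_norm_sub a' b y
  have h6 : ‖a' - a‖ ≤ ‖a' - y‖ + (e + ‖b - a‖) := by
    have i1 := norm_sub_le_norm_sub_add_norm_sub a' y a
    have i2 := norm_sub_le_norm_sub_add_norm_sub y b a
    rw [norm_sub_rev y b] at i2
    linarith
  have h7 := mul_le_mul_of_nonneg_left (h6.trans
    (add_le_add_right (add_le_add_right hn e) _)) hθ
  have h8 := mul_le_mul_of_nonneg_left h3 (by linarith : 0 ≤ θ + 1)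
  rw [zeta, mul_right_comm, ← div_eq_mul_inv, le_div_iff₀ (by linarith)]
  have h9 := mul_le_mul_of_nonneg_right h4 (by linarith : 0 ≤ 1 - θ)
  linarith

end Fejer

/-! ### The rates -/

theorem tendsto_of_tendsto_ofReal {σ : ℕ → ℝ} {σinf : ENNReal} (hpos : ∀ k, 0 < σ k)
    (h : Tendsto (fun k => ENNReal.ofReal (σ k)) atTop (𝓝 σinf)) (hinf : σinf ≠ ⊤) :
    Tendsto σ atTop (𝓝 σinf.toReal) := by
  have := (ENNReal.tendsto_toReal hinf).comp h
  simpa only [Function.comp_def, ENNReal.toReal_ofReal (hpos _).le] using this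

theorem toReal_pos_of_tendsto {σ : ℕ → ℝ} {σinf : ENNReal} (h0 : 0 < σ 0) (hmono : Monotone σ)
    (h : Tendsto (fun k => ENNReal.ofReal (σ k)) atTop (𝓝 σinf)) (hinf : σinf ≠ ⊤) :
    0 < σinf.toReal :=
  h0.trans_le (ge_of_tendsto' (tendsto_of_tendsto_ofReal
    (fun k => h0.trans_le (hmono k.zero_le)) h hinf) fun k => hmono k.zero_le)

theorem tendsto_zeta {σ θ : ℕ → ℝ} {σinf : ENNReal} (κ : ℝ) (h0 : 0 < σ 0)
    (hmono : Monotone σ) (h : Tendsto (fun k => ENNReal.ofReal (σ k)) atTop (𝓝 σinf))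
    (hθ : Tendsto θ atTop (𝓝 0)) :
    Tendsto (fun k => zeta κ (σ k) (θ k)) atTop (𝓝 (zetaInf κ σinf)) := by
  have hpos : ∀ k, 0 < σ k := fun k => h0.trans_le (hmono k.zero_le)
  have h1 : Tendsto (fun k => (1 - θ k)⁻¹) atTop (𝓝 1) := by
    have := (tendsto_const_nhds (x := (1 : ℝ)).sub hθ).inv₀ (by norm_num)
    simpa using this
  have h2 : Tendsto (fun k => κ * (θ k + 1)) atTop (𝓝 κ) := by
    have := (hθ.add_const 1).const_mul κ
    simpa using this
  by_cases hinf : σinf = ⊤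
  · rw [zetaInf, if_pos hinf]
    have hσ : Tendsto σ atTop atTop := by
      rw [hinf] at h
      exact ENNReal.tendsto_ofReal_nhds_top.1 h
    have h3 : Tendsto (fun k => (√(κ ^ 2 + σ k ^ 2))⁻¹) atTop (𝓝 0) := by
      refine tendsto_inv_atTop_zero.comp (tendsto_atTop_mono (fun k => ?_) hσ)
      refine Real.le_sqrt_of_sq_le ?_
      nlinarith [sq_nonneg κ]
    have := ((h2.mul h3).add hθ).mul h1
    simpa [zeta] using this
  · rw [zetaInf, if_neg hinf]
    have hσ := tendsto_of_tendsto_ofReal hpos h hinf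
    have hs := toReal_pos_of_tendsto h0 hmono h hinf
    have h3 : Tendsto (fun k => (√(κ ^ 2 + σ k ^ 2))⁻¹) atTop
        (𝓝 (√(κ ^ 2 + σinf.toReal ^ 2))⁻¹) :=
      ((hσ.pow 2).const_add _).sqrt.inv₀ (Real.sqrt_pos.2 (by positivity)).ne'
    have := ((h2.mul h3).add hθ).mul h1
    simpa [zeta] using this

theorem zetaInf_lt_one {κ : ℝ} {σinf : ENNReal} (hs : σinf ≠ ⊤ → 0 < σinf.toReal) :
    zetaInf κ σinf < 1 := by
  rw [zetaInf]
  split_ifs with hinf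
  · exact one_pos
  · have := hs hinf
    rw [← div_eq_mul_inv, div_lt_one (Real.sqrt_pos.2 (by positivity))]
    refine Real.lt_sqrt_of_sq_lt ?_
    have : 0 < σinf.toReal ^ 2 := by positivity
    linarith

theorem tendsto_zeta' {σ θ' : ℕ → ℝ} {σinf : ENNReal} (κ : ℝ) (h0 : 0 < σ 0)
    (hmono : Monotone σ) (h : Tendsto (fun k => ENNReal.ofReal (σ k)) atTop (𝓝 σinf))
    (hθ : Tendsto θ' atTop (𝓝 0)) :
    Tendsto (fun k => zeta' κ (σ k) (θ' k)) atTop (𝓝 (zetaInf' κ σinf)) := by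
  have hpos : ∀ k, 0 < σ k := fun k => h0.trans_le (hmono k.zero_le)
  have h2 : Tendsto (fun k => κ * (1 + θ' k)) atTop (𝓝 κ) := by
    have := (hθ.const_add 1).const_mul κ
    simpa using this
  by_cases hinf : σinf = ⊤
  · rw [zetaInf', if_pos hinf]
    rw [hinf] at h
    exact h2.div_atTop (ENNReal.tendsto_ofReal_nhds_top.1 h)
  · rw [zetaInf', if_neg hinf]
    exact h2.div (tendsto_of_tendsto_ofReal hpos h hinf)
      (toReal_pos_of_tendsto h0 hmono h hinf).ne'

theorem antitone_zeta {σ θ : ℕ → ℝ} {κ : ℝ} (hκ : 0 ≤ κ) (h0 : 0 < σ 0) (hmono : Monotone σ)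
    (hθ0 : ∀ k, 0 ≤ θ k) (hθ : Antitone θ) (hθ1 : θ 0 < 1) :
    Antitone fun k => zeta κ (σ k) (θ k) := by
  intro i j hij
  have hi : 0 < σ i := h0.trans_le (hmono i.zero_le)
  have h1 := hθ hij
  have h2 := hmono hij
  have h3 : θ i < 1 := (hθ i.zero_le).trans_lt hθ1
  have h4 := hθ0 i
  have h5 := hθ0 j
  have h6 : 0 < 1 - θ i := by linarith
  have h7 : 0 < √(κ ^ 2 + σ i ^ 2) := Real.sqrt_pos.2 (by positivity)
  have h8 : 0 ≤ (1 - θ j)⁻¹ := inv_nonneg.2 (by linarith)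
  simp only [zeta]
  gcongr

theorem exists_linear_rate {d ζ : ℕ → ℝ} {z : ℝ} (hd : ∀ k, 0 ≤ d k)
    (hζ : Tendsto ζ atTop (𝓝 z)) (hz : z < 1) (h : ∀ᶠ k in atTop, d (k + 1) ≤ ζ k * d k) :
    ∃ C : ℝ, ∃ ρ ∈ Set.Ioo (0 : ℝ) 1, ∀ k, d k ≤ C * ρ ^ k := by
  obtain ⟨ρ, hρz, hρ1⟩ := exists_between (max_lt hz one_pos)
  have hρ0 : 0 < ρ := (le_max_right _ _).trans_lt hρz
  have hev := h.and (hζ.eventually_lt_const ((le_max_left _ _).trans_lt hρz))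
  obtain ⟨N, hN⟩ := eventually_atTop.1 hev
  have hsmall : ∀ k ≤ N, d k ≤ (∑ j ∈ Finset.range (N + 1), d j / ρ ^ j) * ρ ^ k := by
    intro k hk
    rw [← div_le_iff₀ (by positivity)]
    exact Finset.single_le_sum (f := fun j => d j / ρ ^ j)
      (fun j _ => div_nonneg (hd j) (by positivity)) (Finset.mem_range.2 (by lia))
  refine ⟨∑ j ∈ Finset.range (N + 1), d j / ρ ^ j, ρ, ⟨hρ0, hρ1⟩, fun k => ?_⟩
  rcases le_total k N with hk | hk
  · exact hsmall k hk
  · induction k, hk using Nat.le_induction with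
    | base => exact hsmall N le_rfl
    | succ k hk ih =>
      obtain ⟨h1, h2⟩ := hN k hk
      calc d (k + 1) ≤ ζ k * d k := h1
        _ ≤ ρ * d k := mul_le_mul_of_nonneg_right h2.le (hd k)
        _ ≤ ρ * ((∑ j ∈ Finset.range (N + 1), d j / ρ ^ j) * ρ ^ k) :=
          mul_le_mul_of_nonneg_left ih hρ0.le
        _ = _ := by ring

theorem isLittleO_of_rate_tendsto_zero {d ζ : ℕ → ℝ} (hd : ∀ k, 0 ≤ d k)
    (hζ : Tendsto ζ atTop (𝓝 0)) (h : ∀ᶠ k in atTop, d (k + 1) ≤ ζ k * d k) :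
    Asymptotics.IsLittleO atTop (fun k => d (k + 1)) d := by
  refine Asymptotics.isLittleO_iff.2 fun c hc => ?_
  filter_upwards [h, hζ.eventually_lt_const hc] with k h1 h2
  rw [Real.norm_of_nonneg (hd _), Real.norm_of_nonneg (hd _)]
  exact h1.trans (mul_le_mul_of_nonneg_right h2.le (hd k))

/-! ### Consequences of the stopping criteria -/

section ALM

variable {A : Matrix (Fin p) (Fin n) ℝ} {I : Finset (Fin p × Fin p)} {lam : ℝ} {σ : ℕ → ℝ}
  {σinf : ENNReal} {w : ℕ → DualSp n I} {x : ℕ → Vec I}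

theorem IsInexactALM.pos (h : IsInexactALM A I σ σinf w x) (k : ℕ) : 0 < σ k :=
  h.sigma_pos.trans_le (h.sigma_mono k.zero_le)

theorem norm_sub_prox_le_of_gap (hlam : 0 < lam) (halm : IsInexactALM A I σ σinf w x) {k : ℕ}
    {q : Vec I} (hq : SignCompl I lam q (slack A I q ((σ k)⁻¹ • (x k - q)))) {η : ℝ} (hη : 0 ≤ η)
    (h : subGap A I lam σ w x k ≤ ((η ^ 2 / (2 * σ k) : ℝ) : EReal)) :
    ‖x (k + 1) - q‖ ≤ η ∧ ‖(w (k + 1)).fst - opSadj A I q‖ ≤ η / √(σ 0) := by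
  have hσ := halm.pos k
  have h1 := gap_estimate hlam hσ hq h
  rw [← halm.update k] at h1
  have h2 : 0 ≤ ‖(w (k + 1)).fst - opSadj A I q‖ ^ 2 := by positivity
  have h3 : 0 ≤ (2 * σ k)⁻¹ * ‖x (k + 1) - q‖ ^ 2 := by positivity
  constructor
  · refine (abs_le_of_sq_le_sq' ?_ hη).2
    have h4 : (2 * σ k)⁻¹ * ‖x (k + 1) - q‖ ^ 2 ≤ (2 * σ k)⁻¹ * η ^ 2 := by
      rw [mul_comm _ (η ^ 2), ← div_eq_mul_inv]
      linarith
    exact le_of_mul_le_mul_left h4 (by positivity)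
  · refine (abs_le_of_sq_le_sq' ?_ (by positivity)).2
    rw [div_pow, Real.sq_sqrt halm.sigma_pos.le]
    have h4 : η ^ 2 / σ k ≤ η ^ 2 / σ 0 :=
      div_le_div_of_nonneg_left (by positivity) halm.sigma_pos (halm.sigma_mono k.zero_le)
    have h5 : η ^ 2 / (2 * σ k) = 1 / 2 * (η ^ 2 / σ k) := by
      field_simp
    linarith

theorem norm_resid_eq (halm : IsInexactALM A I σ σinf w x) (k : ℕ) :
    ‖resid A I (w (k + 1))‖ = (σ k)⁻¹ * ‖x (k + 1) - x k‖ := by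
  have hσ := halm.pos k
  rw [halm.update k, sub_sub_cancel_left, norm_neg, norm_smul, Real.norm_of_nonneg hσ.le,
    inv_mul_cancel_left₀ hσ.ne']

/-- Under (S2) the new iterate is an approximate zero of `𝒯_ℒ`. -/
theorem infDist_TLag_le_of_stopS2 (hlam : 0 < lam) (halm : IsInexactALM A I σ σinf w x)
    {θ' : ℕ → ℝ} (h : StopS2 A I lam σ w x θ') (k : ℕ) :
    (TLag A I lam (WithLp.toLp 2 (w (k + 1), x (k + 1)))).Nonempty ∧
      Metric.infDist 0 (TLag A I lam (WithLp.toLp 2 (w (k + 1), x (k + 1)))) ≤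
        (1 + θ' k) / σ k * ‖x (k + 1) - x k‖ := by
  set u : KKTSp n I := WithLp.toLp 2 (w (k + 1), x (k + 1)) with hu
  have hσ := halm.pos k
  have hb : 0 ≤ θ' k / σ k * ‖x (k + 1) - x k‖ :=
    mul_nonneg (div_nonneg (h.1 k) hσ.le) (norm_nonneg _)
  have key : ∀ η > 0, ∃ u' ∈ TLag A I lam u,
      ‖u'‖ ≤ (1 + θ' k) / σ k * ‖x (k + 1) - x k‖ + η := by
    intro η hη
    have h1 : Metric.infEDist 0 (subdiff (augLagr A I lam (σ k) (x k)) (w (k + 1))) <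
        ENNReal.ofReal (θ' k / σ k * ‖x (k + 1) - x k‖ + η) :=
      (h.2.2 k).trans_lt ((ENNReal.ofReal_lt_ofReal_iff (by positivity)).2 (by linarith))
    obtain ⟨v, hv, hvn⟩ := Metric.infEDist_lt_iff.1 h1
    rw [edist_dist, dist_zero_left, ENNReal.ofReal_lt_ofReal_iff (by positivity)] at hvn
    have hv' := subdiff_augLagr_subset A I hlam hσ _ _ hv
    rw [← halm.update k, mem_subdiff_lagr_iff A I hlam] at hv'
    refine ⟨WithLp.toLp 2 (v, resid A I (w (k + 1))),
      (mem_TLag_iff A I hlam _ _).2 ⟨hv', rfl⟩, ?_⟩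
    refine (norm_le_norm_fst_add_norm_snd _).trans ?_
    simp only [WithLp.toLp_fst, WithLp.toLp_snd]
    rw [norm_resid_eq halm, add_div, add_mul, one_div]
    linarith
  obtain ⟨u', hu', -⟩ := key 1 one_pos
  refine ⟨⟨u', hu'⟩, le_of_forall_pos_le_add fun η hη => ?_⟩
  obtain ⟨v, hv, hvn⟩ := key η hη
  refine (Metric.infDist_le_dist_of_mem hv).trans ?_
  rwa [dist_zero_left]

theorem norm_sub_dualOf_le_infDist (hlam : 0 < lam) {x₀ : Vec I}
    (hx₀ : x₀ ∈ primalSolutions A I lam) (u : KKTSp n I) :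
    ‖u.fst - dualOf A I x₀‖ ≤ Metric.infDist u (zeros (TLag A I lam)) := by
  refine (Metric.le_infDist ⟨WithLp.toLp 2 (dualOf A I x₀, x₀), ?_⟩).2 fun v hv => ?_
  · exact (mem_zeros_TLag_iff A I hlam _).2 ⟨hx₀, rfl⟩
  · obtain ⟨h1, h2⟩ := (mem_zeros_TLag_iff A I hlam v).1 hv
    rw [dualOf_eq_of_mem A I hlam hx₀ h1, ← h2, dist_eq_norm]
    exact WithLp.norm_fst_le _ (u - v)

theorem norm_sub_dualOf_le_zeta' (hlam : 0 < lam) (halm : IsInexactALM A I σ σinf w x)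
    {θ' : ℕ → ℝ} (h : StopS2 A I lam σ w x θ') {x₀ : Vec I}
    (hx₀ : x₀ ∈ primalSolutions A I lam) {κ : ℝ} (hκ : 0 ≤ κ) {k : ℕ}
    (hb : Metric.infDist (WithLp.toLp 2 (w (k + 1), x (k + 1))) (zeros (TLag A I lam)) ≤
      κ * Metric.infDist 0 (TLag A I lam (WithLp.toLp 2 (w (k + 1), x (k + 1))))) :
    ‖w (k + 1) - dualOf A I x₀‖ ≤ zeta' κ (σ k) (θ' k) * ‖x (k + 1) - x k‖ := by
  refine (norm_sub_dualOf_le_infDist hlam hx₀ (WithLp.toLp 2 (w (k + 1), x (k + 1)))).trans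
    (hb.trans ?_)
  refine (mul_le_mul_of_nonneg_left (infDist_TLag_le_of_stopS2 hlam halm h k).2 hκ).trans_eq ?_
  rw [zeta']
  ring

/-- The dual iterates follow the primal ones. -/
theorem tendsto_dual (halm : IsInexactALM A I σ σinf w x) {x₀ : Vec I} {q : ℕ → Vec I}
    {eps : ℕ → ℝ} (heps : Tendsto eps atTop (𝓝 0)) (hx : Tendsto x atTop (𝓝 x₀))
    (hq : Tendsto q atTop (𝓝 x₀))
    (hY : ∀ k, ‖(w (k + 1)).fst - opSadj A I (q k)‖ ≤ eps k / √(σ 0)) :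
    Tendsto w atTop (𝓝 (dualOf A I x₀)) := by
  rw [← tendsto_add_atTop_iff_nat 1]
  have hcS : Continuous (opS A I) := LinearMap.continuous_of_finiteDimensional _
  have hcT : Continuous (opSadj A I) := LinearMap.continuous_of_finiteDimensional _
  have h1 : Tendsto (fun k => (w (k + 1)).fst - opSadj A I (q k)) atTop (𝓝 0) := by
    refine squeeze_zero_norm hY ?_
    simpa using heps.div_const (√(σ 0))
  have h2 : Tendsto (fun k => (w (k + 1)).fst) atTop (𝓝 (opSadj A I x₀)) := by
    simpa using h1.add ((hcT.tendsto x₀).comp hq)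
  have hdx : Tendsto (fun k => x (k + 1) - x k) atTop (𝓝 0) := by
    simpa using (hx.comp (tendsto_add_atTop_nat 1)).sub hx
  have h3 : Tendsto (fun k => resid A I (w (k + 1))) atTop (𝓝 0) := by
    refine squeeze_zero_norm (a := fun k => (σ 0)⁻¹ * ‖x (k + 1) - x k‖) (fun k => ?_) ?_
    · rw [norm_resid_eq halm]
      exact mul_le_mul_of_nonneg_right
        (inv_anti₀ halm.sigma_pos (halm.sigma_mono k.zero_le)) (norm_nonneg _)
    · simpa using hdx.norm.const_mul (σ 0)⁻¹
  have h4 : Tendsto (fun k => (w (k + 1)).snd) atTop (𝓝 (slack A I x₀ 0)) := by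
    have h5 := (h3.add_const (e1 I)).sub ((hcS.tendsto _).comp h2)
    refine h5.congr fun k => ?_
    simp only [resid, Function.comp_apply]
    abel
  exact ((WithLp.prod_continuous_toLp 2 _ _).tendsto _).comp (h2.prodMk_nhds h4)

/-- Existence of proximal points along an inexact ALM sequence. -/
theorem exists_prox_seq (hlam : 0 < lam) (hO : (primalSolutions A I lam).Nonempty)
    (halm : IsInexactALM A I σ σinf w x) :
    ∃ q : ℕ → Vec I, ∀ k, SignCompl I lam (q k) (slack A I (q k) ((σ k)⁻¹ • (x k - q k))) := by
  choose q hq using fun k => exists_prox A I hlam hO (halm.pos k) (x k)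
  exact ⟨q, hq⟩

/-- Cluster points of an inexact proximal sequence are solutions. -/
theorem cluster_mem_primalSolutions (halm : IsInexactALM A I σ σinf w x) {q : ℕ → Vec I}
    (hq : ∀ k, SignCompl I lam (q k) (slack A I (q k) ((σ k)⁻¹ • (x k - q k))))
    (h0 : Tendsto (fun k => q k - x k) atTop (𝓝 0)) {φ : ℕ → ℕ} (hφ : StrictMono φ) {y : Vec I}
    (hy : Tendsto (x ∘ φ) atTop (𝓝 y)) : y ∈ primalSolutions A I lam := by
  rw [mem_primalSolutions_iff_le]
  intro u
  have hqy : Tendsto (fun k => q (φ k)) atTop (𝓝 y) := by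
    have := (h0.comp hφ.tendsto_atTop).add hy
    simpa [Function.comp_def] using this
  have hv : Tendsto (fun k => (σ (φ k))⁻¹ • (x (φ k) - q (φ k))) atTop (𝓝 0) := by
    refine squeeze_zero_norm (a := fun k => (σ 0)⁻¹ * ‖q (φ k) - x (φ k)‖) (fun k => ?_) ?_
    · rw [norm_smul, norm_sub_rev, Real.norm_of_nonneg (inv_nonneg.2 (halm.pos _).le)]
      exact mul_le_mul_of_nonneg_right
        (inv_anti₀ halm.sigma_pos (halm.sigma_mono (φ k).zero_le)) (norm_nonneg _)
    · simpa using ((h0.comp hφ.tendsto_atTop).norm).const_mul (σ 0)⁻¹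
  have hlim := (((continuous_Gam A I lam).tendsto y).comp hqy).add
    (hv.inner (𝕜 := ℝ) (hqy.const_sub u))
  rw [inner_zero_left, add_zero] at hlim
  exact le_of_tendsto' hlim fun k => (hq (φ k)).Gam_subgradient u

end ALM

end DTraceALM

end

theorem mainTheorem1 {p n : ℕ} (A : Matrix (Fin p) (Fin n) ℝ) (I : Finset (Fin p × Fin p))
    (lam : ℝ) (hlam : 0 < lam) (hO : (DTraceALM.primalSolutions A I lam).Nonempty)
    (r : ℝ) (hr : 0 < r) :
    -- the error bound moduli exist, and (D) has exactly one solution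
    (∃ κγ : ℝ, 0 ≤ κγ ∧ DTraceALM.HasErrorBound (DTraceALM.TGam A I lam) r κγ) ∧
    ∃ wstar : DTraceALM.DualSp n I, DTraceALM.dualSolutions A I lam = {wstar} ∧
    ∃ κl : ℝ, 0 ≤ κl ∧ DTraceALM.HasErrorBound (DTraceALM.TLag A I lam) r κl ∧
    ∀ κγ : ℝ, 0 ≤ κγ → DTraceALM.HasErrorBound (DTraceALM.TGam A I lam) r κγ →
    ∀ (σ : ℕ → ℝ) (σinf : ENNReal) (w : ℕ → DTraceALM.DualSp n I) (x : ℕ → DTraceALM.Vec I)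
      (eps : ℕ → ℝ) (α : ℝ) (θ : ℕ → ℝ),
      DTraceALM.IsInexactALM A I σ σinf w x →
      DTraceALM.StopA A I lam σ w x eps α →
      DTraceALM.StopS1 A I lam σ w x θ →
      Metric.infDist (x 0) (DTraceALM.primalSolutions A I lam) ≤ r - α →
      -- convergence of the primal sequence
      (∃ xstar ∈ DTraceALM.primalSolutions A I lam, Tendsto x atTop (𝓝 xstar)) ∧
      (∀ k, θ k < 1 →
        Metric.infDist (x (k + 1)) (DTraceALM.primalSolutions A I lam) ≤
          DTraceALM.zeta κγ (σ k) (θ k) *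
            Metric.infDist (x k) (DTraceALM.primalSolutions A I lam)) ∧
      Tendsto (fun k => DTraceALM.zeta κγ (σ k) (θ k)) atTop (𝓝 (DTraceALM.zetaInf κγ σinf)) ∧
      DTraceALM.zetaInf κγ σinf < 1 ∧
      -- global linear rate
      (∃ C : ℝ, ∃ ρ ∈ Set.Ioo (0 : ℝ) 1, ∀ k,
        Metric.infDist (x k) (DTraceALM.primalSolutions A I lam) ≤ C * ρ ^ k) ∧
      (Antitone θ → θ 0 < 1 → DTraceALM.zeta κγ (σ 0) (θ 0) < 1 →
        Antitone (fun k => DTraceALM.zeta κγ (σ k) (θ k)) ∧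
        ∀ k, Metric.infDist (x (k + 1)) (DTraceALM.primalSolutions A I lam) ≤
          DTraceALM.zeta κγ (σ 0) (θ 0) *
            Metric.infDist (x k) (DTraceALM.primalSolutions A I lam)) ∧
      -- superlinear rate
      (σinf = ⊤ → Asymptotics.IsLittleO atTop
        (fun k => Metric.infDist (x (k + 1)) (DTraceALM.primalSolutions A I lam))
        (fun k => Metric.infDist (x k) (DTraceALM.primalSolutions A I lam))) ∧
      -- convergence of the dual sequence
      Tendsto w atTop (𝓝 wstar) ∧
      ∀ θ' : ℕ → ℝ, DTraceALM.StopS2 A I lam σ w x θ' →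
        (∀ k, ‖w (k + 1) - wstar‖ ≤ DTraceALM.zeta' κl (σ k) (θ' k) * ‖x (k + 1) - x k‖) ∧
        Tendsto (fun k => DTraceALM.zeta' κl (σ k) (θ' k)) atTop
          (𝓝 (DTraceALM.zetaInf' κl σinf)) ∧
        -- for an arbitrary modulus of the error bound for `𝒯_ℒ`, on an arbitrary neighbourhood
        ∀ R κ : ℝ, 0 < R → 0 ≤ κ → DTraceALM.HasErrorBound (DTraceALM.TLag A I lam) R κ →
          ∀ᶠ k in atTop,
            ‖w (k + 1) - wstar‖ ≤ DTraceALM.zeta' κ (σ k) (θ' k) * ‖x (k + 1) - x k‖ := by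
  obtain ⟨κ₀, hκ₀, hb₀⟩ := DTraceALM.TLag_error_bound A I hlam hO hr
  have hcl := DTraceALM.isClosed_primalSolutions A I lam
  obtain ⟨x₀, hx₀⟩ := id hO
  refine ⟨⟨κ₀, hκ₀, DTraceALM.hasErrorBound_TGam hlam hO hκ₀ hb₀⟩, DTraceALM.dualOf A I x₀,
    DTraceALM.dualSolutions_eq A I hlam hx₀, κ₀, hκ₀,
    DTraceALM.hasErrorBound_TLag hlam hO hκ₀ hb₀, ?_⟩
  intro κγ hκγ hγ σ σinf w x eps α θ halm hA hS1 hdist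
  obtain ⟨heps0, hepss, hepsα, hgapA⟩ := hA
  obtain ⟨hθ0, hθs, hgapS⟩ := hS1
  obtain ⟨q, hq⟩ := DTraceALM.exists_prox_seq hlam hO halm
  have hfej : ∀ k, ∀ y ∈ DTraceALM.primalSolutions A I lam,
      ‖q k - y‖ ^ 2 + ‖q k - x k‖ ^ 2 ≤ ‖x k - y‖ ^ 2 :=
    fun k y hy => DTraceALM.prox_fejer (halm.pos k) (hq k) hy
  have hxe := fun k => DTraceALM.norm_sub_prox_le_of_gap hlam halm (hq k) (heps0 k) (hgapA k)
  have hxθ : ∀ k, ‖x (k + 1) - q k‖ ≤ θ k * ‖x (k + 1) - x k‖ := by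
    intro k
    refine (DTraceALM.norm_sub_prox_le_of_gap hlam halm (hq k)
      (mul_nonneg (hθ0 k) (norm_nonneg (x (k + 1) - x k))) ?_).1
    rw [mul_pow, mul_div_right_comm]
    exact hgapS k
  have hr' : ∀ k, Metric.infDist (x k) (DTraceALM.primalSolutions A I lam) ≤ r := by
    intro k
    have h1 := DTraceALM.infDist_le_add_sum_of_fejer hO hcl hfej (fun k => (hxe k).1) k
    have h2 := hepss.sum_le_tsum (Finset.range k) fun j _ => heps0 j
    linarith
  have hq0 := DTraceALM.tendsto_sub_zero_of_fejer hO heps0 hepss hfej fun k => (hxe k).1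
  obtain ⟨xs, hxs, hxlim⟩ := DTraceALM.exists_limit_of_fejer hO heps0 hepss hfej
    (fun k => (hxe k).1) fun φ y hφ hy =>
      DTraceALM.cluster_mem_primalSolutions halm hq hq0 hφ hy
  have hqlim : Tendsto q atTop (𝓝 xs) := by
    simpa using hq0.add hxlim
  have hstep : ∀ k, θ k < 1 →
      Metric.infDist (x (k + 1)) (DTraceALM.primalSolutions A I lam) ≤
        DTraceALM.zeta κγ (σ k) (θ k) *
          Metric.infDist (x k) (DTraceALM.primalSolutions A I lam) := by
    intro k hk
    have hmem := (DTraceALM.mem_TGam_iff A I hlam (q k) _).2 (hq k)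
    have hle : Metric.infDist (q k) (DTraceALM.primalSolutions A I lam) ≤ r := by
      refine le_trans ((abs_le_of_sq_le_sq' ?_ Metric.infDist_nonneg).2) (hr' k)
      have h1 := DTraceALM.infDist_sq_add_le_of_fejer hO hcl (hfej k)
      have : 0 ≤ ‖q k - x k‖ ^ 2 := by positivity
      linarith
    have hbd := hγ (q k) ⟨_, hmem⟩
    rw [DTraceALM.zeros_TGam] at hbd
    refine DTraceALM.infDist_step_le hO hcl (hfej k) hκγ (halm.pos k) (hθ0 k) hk
      ((hbd hle).trans (mul_le_mul_of_nonneg_left ?_ hκγ)) (hxθ k)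
    refine (Metric.infDist_le_dist_of_mem hmem).trans_eq ?_
    rw [dist_zero_left, norm_smul, norm_sub_rev,
      Real.norm_of_nonneg (inv_nonneg.2 (halm.pos k).le)]
  have hζ := DTraceALM.tendsto_zeta κγ halm.sigma_pos halm.sigma_mono halm.sigma_lim
    hθs.tendsto_atTop_zero
  have hζ1 : DTraceALM.zetaInf κγ σinf < 1 := DTraceALM.zetaInf_lt_one
    (DTraceALM.toReal_pos_of_tendsto halm.sigma_pos halm.sigma_mono halm.sigma_lim)
  have hev : ∀ᶠ k in atTop, Metric.infDist (x (k + 1)) (DTraceALM.primalSolutions A I lam) ≤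
      DTraceALM.zeta κγ (σ k) (θ k) *
        Metric.infDist (x k) (DTraceALM.primalSolutions A I lam) := by
    filter_upwards [hθs.tendsto_atTop_zero.eventually_lt_const one_pos] with k hk
    exact hstep k hk
  have hwlim : Tendsto w atTop (𝓝 (DTraceALM.dualOf A I x₀)) := by
    rw [DTraceALM.dualOf_eq_of_mem A I hlam hx₀ hxs]
    exact DTraceALM.tendsto_dual halm hepss.tendsto_atTop_zero hxlim hqlim fun k => (hxe k).2
  refine ⟨⟨xs, hxs, hxlim⟩, hstep, hζ, hζ1,
    DTraceALM.exists_linear_rate (fun _ => Metric.infDist_nonneg) hζ hζ1 hev, ?_, ?_, hwlim, ?_⟩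
  · intro hanti hθ1 _
    have h1 := DTraceALM.antitone_zeta hκγ halm.sigma_pos halm.sigma_mono hθ0 hanti hθ1
    exact ⟨h1, fun k => (hstep k ((hanti k.zero_le).trans_lt hθ1)).trans
      (mul_le_mul_of_nonneg_right (h1 k.zero_le) Metric.infDist_nonneg)⟩
  · intro hinf
    rw [DTraceALM.zetaInf, if_pos hinf] at hζ
    exact DTraceALM.isLittleO_of_rate_tendsto_zero (fun _ => Metric.infDist_nonneg) hζ hev
  · intro θ' hS2
    refine ⟨fun k => ?_, DTraceALM.tendsto_zeta' κ₀ halm.sigma_pos halm.sigma_mono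
      halm.sigma_lim hS2.2.1, fun R κ hR hκ hκb => ?_⟩
    · refine DTraceALM.norm_sub_dualOf_le_zeta' hlam halm hS2 hx₀ hκ₀ ?_
      exact DTraceALM.le_mul_infDist_zero (DTraceALM.infDist_TLag_le_of_stopS2 hlam halm hS2 k).1
        hκ₀ fun v hv => hb₀ _ v hv (hr' (k + 1))
    · have hu : Tendsto (fun k => (WithLp.toLp 2 (w k, x k) : DTraceALM.KKTSp n I)) atTop
          (𝓝 (WithLp.toLp 2 (DTraceALM.dualOf A I x₀, xs))) :=
        ((WithLp.prod_continuous_toLp 2 _ _).tendsto _).comp (hwlim.prodMk_nhds hxlim)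
      have hz : (WithLp.toLp 2 (DTraceALM.dualOf A I x₀, xs) : DTraceALM.KKTSp n I) ∈
          DTraceALM.zeros (DTraceALM.TLag A I lam) :=
        (DTraceALM.mem_zeros_TLag_iff A I hlam _).2
          ⟨hxs, DTraceALM.dualOf_eq_of_mem A I hlam hx₀ hxs⟩
      have hd := ((Metric.continuous_infDist_pt
        (DTraceALM.zeros (DTraceALM.TLag A I lam))).tendsto _).comp
          (hu.comp (tendsto_add_atTop_nat 1))
      rw [Metric.infDist_zero_of_mem hz] at hd
      filter_upwards [hd.eventually_lt_const hR] with k hk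
      exact DTraceALM.norm_sub_dualOf_le_zeta' hlam halm hS2 hx₀ hκ
        (hκb _ (DTraceALM.infDist_TLag_le_of_stopS2 hlam halm hS2 k).1 hk.le)
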